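/- **Theorem.** Consider dual-hop amplify-and-forward (AF) relaying over hops $i=1,2$ with signal powers $P_i>0$, noise variances $N_i>0$ and hardware impairment levels $\kappa_i\ge 0$. Let the channel magnitudes $|h_1|,|h_2|$ be independent Nakagami-$m$ variates, i.e. the channel gains $\rho_i=|h_i|^2$ are Gamma distributed with integer shape $\alpha_i\ge 1$ and scale $\beta_i>0$. Put $d=\kappa_1^2+\kappa_2^2+\kappa_1^2\kappa_2^2$. The end-to-end signal-to-noise-and-distortion ratio is $$\gamma=\frac{\rho_1\rho_2}{\rho_1\rho_2 d+\rho_1 b_1+\rho_2 b_2+c},$$ where, for variable gain relaying, $$b_1=\frac{N_2(1+\kappa_1^2)}{P_2},\qquad b_2=\frac{N_1(1+\kappa_2^2)}{P_1},\qquad c=\frac{N_1N_2}{P_1P_2},$$ and, for fixed gain relaying, $$b_1=0,\qquad b_2=\frac{N_1(1+\kappa_2^2)}{P_1},\qquad c=\frac{N_2}{P_1G^2},\qquad G=\sqrt{\frac{P_2}{P_1\,\mathbb E\{\rho_1\}(1+\kappa_1^2)+N_1}} .$$ Then, for both protocols, the ergodic capacity $C=\frac12\,\mathbb E\{\log_2(1+\gamma)\}$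 (in bits/channel use) is finite and satisfies $$C\le \frac12\log_2\left(1+\frac{\mathcal J}{\mathcal J d+1}\right),$$ where $$\mathcal J=\mathbb E\left\{\frac{\rho_1\rho_2}{\rho_1b_1+\rho_2b_2+c}\right\}<\infty .$$ For variable gain relaying, $\mathcal J$ is given explicitly by $$\mathcal J=\sum_{n=0}^{\alpha_1-1}\sum_{k=0}^{\alpha_2-1}\sum_{m=0}^{k}\sum_{q=0}^{n+m+2}\frac{(n+1)\,\beta_1^{\frac{n-m+2-2\alpha_1}{2}}\beta_2^{\frac{m-n-2k}{2}}}{(k-m)!\,(\alpha_1-n-1)!}\cdot\frac{\left(\frac{b_1}{b_2}\right)^{\frac{n-m+2+2k}{2}}\left(\frac{c}{b_1}\right)^{q}}{c\,(-1)^{\alpha_1+k-q+1}}\binom{n+m+2}{q}\,\frac{d^{\,\alpha_1+k-q+1}}{dt^{\,\alpha_1+k-q+1}}\Phi_{n,m}(t)\Big|_{t=\frac1{\beta_1}+\frac{b_1}{b_2\beta_2}},$$ $$\Phi_{n,m}(t)=e^{\frac{ct}{2b_1}}\,W_{-\frac{n+m+2}{2},\frac{n-m+1}{2}}\!\left(\tfrac{c}{2b_1}\Big(t-\sqrt{t^2-\tfrac{4b_1}{b_2\beta_1\beta_2}}\Big)\right)W_{-\frac{n+m+2}{2},\frac{n-m+1}{2}}\!\left(\tfrac{c}{2b_1}\Big(t+\sqrt{t^2-\tfrac{4b_1}{b_2\beta_1\beta_2}}\Big)\right),$$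 with $W_{\kappa,\nu}$ the Whittaker $W$ function, which for $\Re(\nu-\kappa)>-\frac12$ and $\Re z>0$ is $W_{\kappa,\nu}(z)=\frac{z^{\nu+1/2}e^{-z/2}}{\Gamma(\nu-\kappa+\frac12)}\int_0^\infty e^{-zs}s^{\nu-\kappa-\frac12}(1+s)^{\nu+\kappa-\frac12}\,ds$ (all powers and square roots are principal values; where the radicand is negative, the two arguments are complex conjugates of each other). For fixed gain relaying, $b_1=0$ and $\mathcal J$ is the limit of this expression as $b_1\downarrow 0$ with $b_2,c$ held fixed. -/

import Mathlib

open MeasureTheory ProbabilityTheory Filter Topology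

noncomputable section

namespace AFRelay

/-- The channel coefficient `h` undergoes Nakagami fading with shape `α` and scale `β`: the channel
gain `|h|²` is Gamma distributed with shape `α` and scale `β` (Mathlib's Gamma distribution is
parametrized by the rate, which is `1 / β`). -/
def IsNakagami {Ω : Type*} [MeasurableSpace Ω] (μ : Measure Ω) (h : Ω → ℂ) (α : ℕ) (β : ℝ) :
    Prop :=
  HasLaw (fun ω => ‖h ω‖ ^ 2) (gammaMeasure (α : ℝ) (1 / β)) μ

/-- The distortion parameter `d`, a function of the impairment levels `κ₁, κ₂` of the two hops. -/
def distortion (κ₁ κ₂ : ℝ) : ℝ :=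
  κ₁ ^ 2 + κ₂ ^ 2 + κ₁ ^ 2 * κ₂ ^ 2

/-- The fixed amplification factor of the relay; `meanGain` is the average gain of the first hop. -/
def fixedGain (P₁ P₂ N₁ κ₁ meanGain : ℝ) : ℝ :=
  Real.sqrt (P₂ / (P₁ * meanGain * (1 + κ₁ ^ 2) + N₁))

/-- End-to-end signal-to-noise-and-distortion ratio for fixed gain relaying with amplification
factor `G` and channel gains `ρ₁, ρ₂`. -/
def sndrFixed (P₁ N₁ N₂ κ₁ κ₂ G ρ₁ ρ₂ : ℝ) : ℝ :=
  ρ₁ * ρ₂ /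
    (ρ₁ * ρ₂ * distortion κ₁ κ₂ + ρ₂ * (1 + κ₂ ^ 2) * (N₁ / P₁) + N₂ / (P₁ * G ^ 2))

/-- End-to-end signal-to-noise-and-distortion ratio for variable gain relaying with channel gains
`ρ₁, ρ₂`. -/
def sndrVariable (P₁ P₂ N₁ N₂ κ₁ κ₂ ρ₁ ρ₂ : ℝ) : ℝ :=
  ρ₁ * ρ₂ /
    (ρ₁ * ρ₂ * distortion κ₁ κ₂ + ρ₁ * (1 + κ₁ ^ 2) * (N₂ / P₂) + ρ₂ * (1 + κ₂ ^ 2) * (N₁ / P₁)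
      + N₁ * N₂ / (P₁ * P₂))

/-- Ergodic capacity (bits per channel use) of a two-slot relaying protocol with random end-to-end
signal-to-noise-and-distortion ratio `γ`. -/
def ergodicCapacity {Ω : Type*} [MeasurableSpace Ω] (μ : Measure Ω) (γ : Ω → ℝ) : ℝ :=
  1 / 2 * ∫ ω, Real.logb 2 (1 + γ ω) ∂μ

/-- `ρ₁ ρ₂ / (ρ₁ b₁ + ρ₂ b₂ + c)`. -/
def gainRatio (b₁ b₂ c ρ₁ ρ₂ : ℝ) : ℝ :=
  ρ₁ * ρ₂ / (ρ₁ * b₁ + ρ₂ * b₂ + c)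

/-- The Whittaker function `W_{κ,ν}(z)` through its integral representation, which is valid for
`Re (ν - κ) > -1/2` and `Re z > 0`. It is only used in that range: with `κ = -(n + m + 2) / 2` and
`ν = (n - m + 1) / 2` one has `ν - κ = n + 3 / 2`. -/
def whittakerW (κ ν z : ℂ) : ℂ :=
  z ^ (ν + 1 / 2) * Complex.exp (-z / 2) / Complex.Gamma (ν - κ + 1 / 2) *
    ∫ t in Set.Ioi (0 : ℝ),
      Complex.exp (-z * t) * (t : ℂ) ^ (ν - κ - 1 / 2) * (1 + (t : ℂ)) ^ (ν + κ - 1 / 2)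

/-- The function of the real variable `t` whose derivatives enter the closed form. The arguments of
the two Whittaker functions are complex conjugates of each other where the radicand is negative;
`· ^ (1 / 2 : ℂ)` is the principal square root. -/
def whittakerProduct (n m : ℕ) (b₁ b₂ c β₁ β₂ : ℝ) (t : ℝ) : ℂ :=
  let root : ℂ := ((t ^ 2 - 4 * b₁ / (b₂ * β₁ * β₂) : ℝ) : ℂ) ^ (1 / 2 : ℂ)
  Complex.exp (c * t / (2 * b₁)) *
    whittakerW (-((n : ℂ) + m + 2) / 2) (((n : ℂ) - m + 1) / 2) (c / (2 * b₁) * (t - root)) *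
    whittakerW (-((n : ℂ) + m + 2) / 2) (((n : ℂ) - m + 1) / 2) (c / (2 * b₁) * (t + root))

/-- The closed form `𝒥` as a finite sum of derivatives, for `b₁, b₂, c > 0`. All natural number
subtractions are exact for the indices that occur. -/
def calJ (α₁ α₂ : ℕ) (β₁ β₂ b₁ b₂ c : ℝ) : ℂ :=
  ∑ n ∈ Finset.range α₁, ∑ k ∈ Finset.range α₂, ∑ m ∈ Finset.range (k + 1),
    ∑ q ∈ Finset.range (n + m + 3),
      ((((n + 1 : ℝ) * β₁ ^ (((n : ℝ) - m + 2 - 2 * α₁) / 2) * β₂ ^ (((m : ℝ) - n - 2 * k) / 2)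
            / ((k - m).factorial * (α₁ - n - 1).factorial))
          * ((b₁ / b₂) ^ (((n : ℝ) - m + 2 + 2 * k) / 2) * (c / b₁) ^ q
            / (c * (-1) ^ (α₁ + k + 1 - q)))
          * ((n + m + 2).choose q : ℝ) : ℝ) : ℂ)
        * iteratedDeriv (α₁ + k + 1 - q) (whittakerProduct n m b₁ b₂ c β₁ β₂)
            (1 / β₁ + b₁ / (b₂ * β₂))

end AFRelay

end

/-!
The bound on the capacity is Jensen's inequality. With `g` the gain ratio and `d` the distortion
parameter, `γ = g / (g * d + 1)`, and `x ↦ log (1 + x / (x * d + 1))` is concave, so its tangent line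
at `𝔼 g` lies above it (`log_one_add_div_le`). Since `g ≤ ρ₁ / b₂`, everything is integrable, and
fixed gain relaying follows from variable gain relaying by dominated convergence as `b₁ → 0`. What
remains is to evaluate `𝔼 g` for `b₁ > 0`.

*The mean as a double integral.* The layer cake formula expresses `𝔼 g` through `ℙ (g > w)`. For
`w = c / (b₁ * b₂) * y` the event `g > w` reads `ρ₁ = c / b₁ * y + u` with `u > 0` and `ρ₂` above the
threshold `c / b₂ * y + c ^ 2 / (b₁ * b₂) * y * (1 + y) / u`. The tail of `ρ₂` is an exponential times
a polynomial, and expanding all powers by the binomial theorem yields a finite sum of integrals over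
the quadrant `y, u > 0` of
`y ^ r * (1 + y) ^ m * u ^ (n - m) * exp (-σ * y - A * u - B * y * (1 + y) / u)`
(`mul_erlangJoint_eq_sum`).

*Products of Whittaker functions as Laplace transforms.* The Whittaker functions in question are, up
to elementary factors, the Laplace transforms `K(z) = ∫ e ^ (-z * s) s ^ (n+1) / (1 + s) ^ (m+1) ds`.
Kummer's transformation (`lkummer_symm`) rewrites one of the two factors of `K(z₁) * K(z₂)`, and the
substitution `S = y + v`, `U = y + y * (1 + y) / v` turns the product into the Laplace transform at
`z₁ + z₂` of a density on the quadrant which depends on `z₁`, `z₂` only through `z₁ * z₂`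
(`lkummer_mul_lkummer_eq`). The two arguments in `whittakerProduct` have constant product, and their
sum is proportional to `t`, so that `whittakerProduct` is a Laplace transform in `t`. As the
arguments are not real for small `t`, and the point at which the derivatives are taken may be the
branch point of the square root, the identity is needed for complex arguments as well; it follows
from the real one by analytic continuation in `z₁` along the right half plane
(`complexMGF_mul_complexMGF_kummerMeasure`).

*Derivatives.* Each derivative in `t` brings down a factor `-c / b₁ * y`; the sum over `q` in the
closed form is the binomial expansion of `(1 + y) ^ (n + m + 2)`, which turns the density of the
Laplace transform into the integrand above. Laplace transforms are treated as moment generating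
functions of `-y`, for which differentiation and analyticity are available.
-/

namespace AFRelay

open Set Real

/-! ### Products of real confluent hypergeometric integrals -/

lemma setLIntegral_Ioi_zero_comp_mul {c : ℝ} (hc : 0 < c) (f : ℝ → ENNReal) :
    ∫⁻ x in Ioi 0, f x = ENNReal.ofReal c * ∫⁻ x in Ioi 0, f (c * x) := by
  have himg : (fun x => c * x) '' Ioi (0 : ℝ) = Ioi 0 := by
    rw [image_mul_left_Ioi hc, mul_zero]
  have h := lintegral_image_eq_lintegral_abs_deriv_mul (s := Ioi (0 : ℝ)) (f := fun x => c * x)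
    (f' := fun _ => c) measurableSet_Ioi
    (fun x _ => by simpa using ((hasDerivAt_id x).const_mul c).hasDerivWithinAt)
    (mul_right_injective₀ hc.ne').injOn f
  rw [himg] at h
  rw [h, abs_of_pos hc, lintegral_const_mul' _ _ ENNReal.ofReal_ne_top]

lemma setLIntegral_Ioi_eq_comp_add (c : ℝ) (f : ℝ → ENNReal) :
    ∫⁻ x in Ioi c, f x = ∫⁻ u in Ioi 0, f (c + u) := by
  have himg : (fun x => c + x) '' Ioi (0 : ℝ) = Ioi c := by simp
  have h := lintegral_image_eq_lintegral_abs_deriv_mul (s := Ioi (0 : ℝ)) (f := fun x => c + x)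
    (f' := fun _ => 1) measurableSet_Ioi
    (fun x _ => by simpa using ((hasDerivAt_id x).const_add c).hasDerivWithinAt)
    (add_right_injective c).injOn f
  rw [himg] at h
  simpa using h

lemma lintegral_pow_mul_exp_neg_mul (k : ℕ) {r : ℝ} (hr : 0 < r) :
    ∫⁻ t in Ioi (0 : ℝ), ENNReal.ofReal (t ^ k * exp (-(r * t)))
      = ENNReal.ofReal (k.factorial / r ^ (k + 1)) := by
  have key : ∫ t : ℝ in Ioi 0, t ^ k * exp (-(r * t)) = k.factorial / r ^ (k + 1) := by
    have h := integral_rpow_mul_exp_neg_mul_Ioi (a := k + 1) (by positivity) hr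
    simp only [add_sub_cancel_right, rpow_natCast] at h
    rw [h, Gamma_nat_eq_factorial]
    norm_cast
    rw [one_div, inv_pow]; ring
  rw [← key, ofReal_integral_eq_lintegral_ofReal]
  · exact .of_integral_ne_zero (by rw [key]; positivity)
  · exact (ae_restrict_mem measurableSet_Ioi).mono fun t (ht : 0 < t) => by positivity

/-- The Laplace transform at `z` of `s ^ p / (1 + s) ^ q` on the half line, which is Tricomi's
confluent hypergeometric function up to a factor `p !`. -/
noncomputable def lkummer (p q : ℕ) (z : ℝ) : ENNReal :=
  ∫⁻ s in Ioi (0 : ℝ), ENNReal.ofReal (s ^ p / (1 + s) ^ q * exp (-(z * s)))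

lemma lkummer_lt_top (p q : ℕ) {z : ℝ} (hz : 0 < z) : lkummer p q z < ⊤ := by
  refine lt_of_le_of_lt ?_ (lt_of_eq_of_lt (lintegral_pow_mul_exp_neg_mul p hz)
    ENNReal.ofReal_lt_top)
  refine setLIntegral_mono' measurableSet_Ioi fun s (hs : 0 < s) => ENNReal.ofReal_le_ofReal ?_
  gcongr
  exact div_le_self (by positivity) (one_le_pow₀ (by linarith))

/-- Kummer's transformation: both sides are, by Tonelli's theorem, the double integral of
`U ^ q * τ ^ p * exp (-τ * (1 + U) - z * U)`. -/
lemma lkummer_symm (p q : ℕ) {z : ℝ} (hz : 0 < z) :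
    ENNReal.ofReal p.factorial * lkummer q (p + 1) z
      = ENNReal.ofReal (q.factorial * (z ^ p / z ^ q)) * lkummer p (q + 1) z := by
  have h1 : ENNReal.ofReal p.factorial * lkummer q (p + 1) z =
      ∫⁻ U in Ioi (0 : ℝ), ∫⁻ τ in Ioi (0 : ℝ),
        ENNReal.ofReal (U ^ q * τ ^ p * exp (-(τ * (1 + U)) - z * U)) := by
    rw [lkummer, ← lintegral_const_mul' _ _ ENNReal.ofReal_ne_top]
    refine setLIntegral_congr_fun measurableSet_Ioi fun U (hU : 0 < U) => ?_
    have hU1 : 0 < 1 + U := by positivity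
    rw [← ENNReal.ofReal_mul (by positivity),
      show (p.factorial : ℝ) * (U ^ q / (1 + U) ^ (p + 1) * exp (-(z * U)))
        = U ^ q * exp (-(z * U)) * (p.factorial / (1 + U) ^ (p + 1)) by ring,
      ENNReal.ofReal_mul (by positivity), ← lintegral_pow_mul_exp_neg_mul p hU1,
      ← lintegral_const_mul' _ _ ENNReal.ofReal_ne_top]
    refine setLIntegral_congr_fun measurableSet_Ioi fun τ (hτ : 0 < τ) => ?_
    rw [← ENNReal.ofReal_mul (by positivity)]
    congr 1
    rw [show -(τ * (1 + U)) - z * U = -(z * U) + -((1 + U) * τ) by ring, exp_add]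
    ring
  have h2 : ENNReal.ofReal (q.factorial * (z ^ p / z ^ q)) * lkummer p (q + 1) z =
      ∫⁻ τ in Ioi (0 : ℝ), ∫⁻ U in Ioi (0 : ℝ),
        ENNReal.ofReal (U ^ q * τ ^ p * exp (-(τ * (1 + U)) - z * U)) := by
    rw [setLIntegral_Ioi_zero_comp_mul hz, lkummer,
      ← lintegral_const_mul' _ _ ENNReal.ofReal_ne_top,
      ← lintegral_const_mul' _ _ ENNReal.ofReal_ne_top]
    refine setLIntegral_congr_fun measurableSet_Ioi fun s (hs : 0 < s) => ?_
    have hs1 : 0 < z * (1 + s) := by positivity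
    rw [← ENNReal.ofReal_mul (by positivity),
      show (q.factorial * (z ^ p / z ^ q)) * (s ^ p / (1 + s) ^ (q + 1) * exp (-(z * s)))
        = z * (((z * s) ^ p * exp (-(z * s))) * (q.factorial / (z * (1 + s)) ^ (q + 1))) by
          rw [mul_pow, mul_pow]; field_simp; ring,
      ENNReal.ofReal_mul hz.le, ENNReal.ofReal_mul (p := (z * s) ^ p * exp (-(z * s)))
        (by positivity), ← lintegral_pow_mul_exp_neg_mul q hs1,
      ← lintegral_const_mul' _ _ ENNReal.ofReal_ne_top]
    congr 1
    refine setLIntegral_congr_fun measurableSet_Ioi fun U (hU : 0 < U) => ?_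
    rw [← ENNReal.ofReal_mul (by positivity)]
    congr 1
    rw [show -(z * s * (1 + U)) - z * U = -(z * s) + -(z * (1 + s) * U) by ring, exp_add]
    ring
  rw [h1, h2]
  exact lintegral_lintegral_swap (by fun_prop)

/-- The density of the measure whose Laplace transform in the first variable is the product of two
Whittaker functions. Integrating out the second variable yields a modified Bessel function of the
second kind. -/
noncomputable def besselDensity (n m : ℕ) (A B : ℝ) (p : ℝ × ℝ) : ℝ :=
  p.1 ^ m / (1 + p.1) ^ (n + 2) * (p.2 ^ n / p.2 ^ m)
    * exp (-(A * p.2) - B * (p.1 * (1 + p.1)) / p.2)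

lemma measurable_besselDensity (n m : ℕ) (A B : ℝ) : Measurable (besselDensity n m A B) := by
  unfold besselDensity
  fun_prop

lemma besselDensity_nonneg (n m : ℕ) (A B : ℝ) {p : ℝ × ℝ} (h1 : 0 < p.1) (h2 : 0 < p.2) :
    0 ≤ besselDensity n m A B p := by
  unfold besselDensity
  positivity

/-- The substitution `S = y + v`, `U = y + y * (1 + y) / v` in a double integral over the positive
quadrant. It is carried out as the succession of the scalings `U = (1 + S) * r`, `S = (1 + r) * v`,
`r = y / v`. -/
lemma lintegral_lintegral_quadrant_subst {F : ℝ → ℝ → ENNReal}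
    (hF : Measurable (Function.uncurry F)) :
    ∫⁻ S in Ioi (0 : ℝ), ∫⁻ U in Ioi (0 : ℝ), F S U =
      ∫⁻ v in Ioi (0 : ℝ), ∫⁻ y in Ioi (0 : ℝ),
        ENNReal.ofReal ((y + v) * (1 + y + v) / v ^ 2) * F (y + v) (y + y * (1 + y) / v) := by
  calc ∫⁻ S in Ioi (0 : ℝ), ∫⁻ U in Ioi (0 : ℝ), F S U
      = ∫⁻ S in Ioi (0 : ℝ), ∫⁻ r in Ioi (0 : ℝ),
          ENNReal.ofReal (1 + S) * F S ((1 + S) * r) := by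
        refine setLIntegral_congr_fun measurableSet_Ioi fun S (hS : 0 < S) => ?_
        rw [lintegral_const_mul' _ _ ENNReal.ofReal_ne_top]
        exact setLIntegral_Ioi_zero_comp_mul (c := 1 + S) (by positivity) _
    _ = ∫⁻ r in Ioi (0 : ℝ), ∫⁻ S in Ioi (0 : ℝ),
          ENNReal.ofReal (1 + S) * F S ((1 + S) * r) := by
        refine lintegral_lintegral_swap (Measurable.aemeasurable ?_)
        exact Measurable.mul (by fun_prop)
          (hF.comp (f := fun p : ℝ × ℝ => (p.1, (1 + p.1) * p.2)) (by fun_prop))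
    _ = ∫⁻ r in Ioi (0 : ℝ), ∫⁻ v in Ioi (0 : ℝ), ENNReal.ofReal (1 + r) *
          (ENNReal.ofReal (1 + (1 + r) * v) *
            F ((1 + r) * v) ((1 + (1 + r) * v) * r)) := by
        refine setLIntegral_congr_fun measurableSet_Ioi fun r (hr : 0 < r) => ?_
        rw [lintegral_const_mul' _ _ ENNReal.ofReal_ne_top]
        exact setLIntegral_Ioi_zero_comp_mul (c := 1 + r) (by positivity) _
    _ = ∫⁻ v in Ioi (0 : ℝ), ∫⁻ r in Ioi (0 : ℝ), ENNReal.ofReal (1 + r) *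
          (ENNReal.ofReal (1 + (1 + r) * v) *
            F ((1 + r) * v) ((1 + (1 + r) * v) * r)) := by
        refine lintegral_lintegral_swap (Measurable.aemeasurable ?_)
        exact Measurable.mul (by fun_prop) (Measurable.mul (by fun_prop)
          (hF.comp (f := fun p : ℝ × ℝ => ((1 + p.1) * p.2, (1 + (1 + p.1) * p.2) * p.1))
            (by fun_prop)))
    _ = _ := by
        refine setLIntegral_congr_fun measurableSet_Ioi fun v (hv : 0 < v) => ?_
        have h := setLIntegral_Ioi_zero_comp_mul (c := v⁻¹) (by positivity) fun r =>
          ENNReal.ofReal (1 + r) * (ENNReal.ofReal (1 + (1 + r) * v) *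
            F ((1 + r) * v) ((1 + (1 + r) * v) * r))
        refine h.trans ?_
        rw [← lintegral_const_mul' _ _ ENNReal.ofReal_ne_top]
        refine setLIntegral_congr_fun measurableSet_Ioi fun y (hy : 0 < y) => ?_
        have e1 : (1 + v⁻¹ * y) * v = y + v := by field_simp; ring
        have e2 : (1 + (y + v)) * (v⁻¹ * y) = y + y * (1 + y) / v := by field_simp; ring
        have e3 : (y + v) * (1 + y + v) / v ^ 2 = v⁻¹ * ((1 + v⁻¹ * y) * (1 + (y + v))) := by
          field_simp; ring
        simp only [e1, e2]
        rw [e3, ENNReal.ofReal_mul (by positivity), ENNReal.ofReal_mul (by positivity), mul_assoc,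
          mul_assoc]

/-- The product of two Laplace transforms as a double integral, by the substitution of
`lintegral_lintegral_quadrant_subst`. -/
lemma lkummer_mul_lkummer (n m : ℕ) (z₁ z₂ : ℝ) :
    lkummer (n + 1) (m + 1) z₁ * lkummer m (n + 2) z₂ =
      ∫⁻ y in Ioi (0 : ℝ), ∫⁻ v in Ioi (0 : ℝ),
        ENNReal.ofReal (exp (-((z₁ + z₂) * y)) * besselDensity n m z₁ z₂ (y, v)) := by
  have hmeas : ∀ (p q : ℕ) (z : ℝ), Measurable fun s : ℝ =>
      ENNReal.ofReal (s ^ p / (1 + s) ^ q * exp (-(z * s))) := fun p q z => by fun_prop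
  have hdens : Measurable (Function.uncurry fun y v : ℝ =>
      ENNReal.ofReal (exp (-((z₁ + z₂) * y)) * besselDensity n m z₁ z₂ (y, v))) := by
    unfold Function.uncurry besselDensity
    fun_prop
  rw [lintegral_lintegral_swap hdens.aemeasurable, lkummer,
    ← lintegral_mul_const _ (hmeas _ _ _)]
  simp_rw [lkummer, ← lintegral_const_mul _ (hmeas _ _ _)]
  rw [lintegral_lintegral_quadrant_subst (by unfold Function.uncurry; fun_prop)]
  refine setLIntegral_congr_fun measurableSet_Ioi fun v (hv : 0 < v) => ?_
  refine setLIntegral_congr_fun measurableSet_Ioi fun y (hy : 0 < y) => ?_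
  rw [← ENNReal.ofReal_mul (by positivity), ← ENNReal.ofReal_mul (by positivity)]
  congr 1
  have e3 : 1 + (y + y * (1 + y) / v) = (1 + y) * (y + v) / v := by field_simp; ring
  have e5 : y + y * (1 + y) / v = y * (1 + y + v) / v := by field_simp; ring
  have hexp : exp (-(z₁ * (y + v))) * exp (-(z₂ * (y + y * (1 + y) / v)))
      = exp (-((z₁ + z₂) * y)) * exp (-(z₁ * v) - z₂ * (y * (1 + y)) / v) := by
    rw [← exp_add, ← exp_add]; congr 1; ring
  have hrat : (y + v) * (1 + y + v) / v ^ 2 * ((y + v) ^ (n + 1) / (1 + (y + v)) ^ (m + 1) *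
      ((y + y * (1 + y) / v) ^ m / (1 + (y + y * (1 + y) / v)) ^ (n + 2)))
      = y ^ m / (1 + y) ^ (n + 2) * (v ^ n / v ^ m) := by
    rw [e3, e5, div_pow, div_pow, mul_pow, mul_pow, ← add_assoc]
    field_simp
    ring
  simp only [besselDensity]
  linear_combination (exp (-(z₁ * (y + v))) * exp (-(z₂ * (y + y * (1 + y) / v)))) * hrat +
    (y ^ m / (1 + y) ^ (n + 2) * (v ^ n / v ^ m)) * hexp

/-! ### Laplace transforms as moment generating functions -/

/-- The measure on the half line with density `s ^ p / (1 + s) ^ q`. -/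
noncomputable def kummerMeasure (p q : ℕ) : Measure ℝ :=
  (volume.restrict (Ioi 0)).withDensity fun s => ENNReal.ofReal (s ^ p / (1 + s) ^ q)

/-- The measure on the positive quadrant with density `besselDensity`. -/
noncomputable def besselMeasure (n m : ℕ) (A B : ℝ) : Measure (ℝ × ℝ) :=
  ((volume.restrict (Ioi 0)).prod (volume.restrict (Ioi 0))).withDensity fun p =>
    ENNReal.ofReal (besselDensity n m A B p)

lemma ae_quadrant_pos :
    ∀ᵐ p : ℝ × ℝ ∂((volume.restrict (Ioi 0)).prod (volume.restrict (Ioi 0))),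
      0 < p.1 ∧ 0 < p.2 := by
  rw [Measure.prod_restrict]
  exact (ae_restrict_mem (measurableSet_Ioi.prod measurableSet_Ioi)).mono fun p hp => hp

lemma lintegral_exp_kummerMeasure (p q : ℕ) (z : ℝ) :
    ∫⁻ s, ENNReal.ofReal (exp (z * -s)) ∂kummerMeasure p q = lkummer p q z := by
  rw [kummerMeasure, lintegral_withDensity_eq_lintegral_mul _ (by fun_prop) (by fun_prop), lkummer]
  refine setLIntegral_congr_fun measurableSet_Ioi fun s (hs : 0 < s) => ?_
  simp only [Pi.mul_apply]
  rw [← ENNReal.ofReal_mul (by positivity), mul_neg]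

lemma mgf_kummerMeasure (p q : ℕ) (z : ℝ) :
    mgf (fun s => -s) (kummerMeasure p q) z = (lkummer p q z).toReal := by
  rw [mgf, integral_eq_lintegral_of_nonneg_ae (ae_of_all _ fun s => (exp_pos _).le)
    (by fun_prop), lintegral_exp_kummerMeasure]

lemma mem_interior_integrableExpSet_kummerMeasure (p q : ℕ) {z : ℝ} (hz : 0 < z) :
    z ∈ interior (integrableExpSet (fun s => -s) (kummerMeasure p q)) := by
  refine interior_maximal (t := Ioi 0) (fun t ht => ?_) isOpen_Ioi hz
  rw [integrableExpSet, mem_ofPred_eq, ← lintegral_ofReal_ne_top_iff_integrable (by fun_prop)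
    (ae_of_all _ fun s => (exp_pos _).le), lintegral_exp_kummerMeasure]
  exact (lkummer_lt_top p q ht).ne

lemma lintegral_besselMeasure (n m : ℕ) (A B : ℝ) {f : ℝ × ℝ → ℝ} (hf : Measurable f)
    (hf0 : ∀ y v, 0 < y → 0 < v → 0 ≤ f (y, v)) :
    ∫⁻ p, ENNReal.ofReal (f p) ∂besselMeasure n m A B =
      ∫⁻ y in Ioi (0 : ℝ), ∫⁻ v in Ioi (0 : ℝ),
        ENNReal.ofReal (f (y, v) * besselDensity n m A B (y, v)) := by
  have hm := measurable_besselDensity n m A B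
  rw [besselMeasure, lintegral_withDensity_eq_lintegral_mul _ (by fun_prop) (by fun_prop),
    lintegral_prod _ (Measurable.aemeasurable (by fun_prop))]
  refine setLIntegral_congr_fun measurableSet_Ioi fun y (hy : 0 < y) => ?_
  refine setLIntegral_congr_fun measurableSet_Ioi fun v (hv : 0 < v) => ?_
  simp only [Pi.mul_apply]
  rw [mul_comm, ← ENNReal.ofReal_mul (hf0 y v hy hv)]

/-- The product of two Laplace transforms depends on `z₁`, `z₂` only through their sum and product:
Kummer's transformation makes the factors asymmetric, so that the substitution applies, and the
scaling `v ↦ z₂ / B * v` compensates for the factor which it introduces. -/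
lemma lkummer_mul_lkummer_eq (n m : ℕ) {z₁ z₂ A B : ℝ} (hz₁ : 0 < z₁) (hz₂ : 0 < z₂)
    (hA : 0 < A) (hB : 0 < B) (h : z₁ * z₂ = A * B) :
    lkummer (n + 1) (m + 1) z₁ * lkummer (n + 1) (m + 1) z₂ =
      ENNReal.ofReal ((n + 1).factorial / m.factorial * (B ^ m / B ^ (n + 1))) *
        ∫⁻ p, ENNReal.ofReal (exp ((z₁ + z₂) * -p.1)) ∂besselMeasure n m A B := by
  have hl : z₂ / B = A / z₁ := by field_simp; linarith
  have hl0 : 0 < z₂ / B := by positivity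
  have h1 : lkummer (n + 1) (m + 1) z₁ * lkummer m (n + 2) z₂ =
      ENNReal.ofReal ((z₂ / B) ^ (n + 1) / (z₂ / B) ^ m) *
        ∫⁻ p, ENNReal.ofReal (exp ((z₁ + z₂) * -p.1)) ∂besselMeasure n m A B := by
    rw [lkummer_mul_lkummer, lintegral_besselMeasure _ _ _ _ (by fun_prop)
      (fun _ _ _ _ => (exp_pos _).le), ← lintegral_const_mul' _ _ ENNReal.ofReal_ne_top]
    refine setLIntegral_congr_fun measurableSet_Ioi fun y (hy : 0 < y) => ?_
    refine (setLIntegral_Ioi_zero_comp_mul hl0 _).trans ?_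
    rw [← lintegral_const_mul' _ _ ENNReal.ofReal_ne_top,
      ← lintegral_const_mul' _ _ ENNReal.ofReal_ne_top]
    refine setLIntegral_congr_fun measurableSet_Ioi fun v (hv : 0 < v) => ?_
    rw [← ENNReal.ofReal_mul (by positivity), ← ENNReal.ofReal_mul (by positivity)]
    congr 1
    simp only [besselDensity]
    have e1 : z₁ * (z₂ / B * v) = A * v := by rw [hl]; field_simp
    have e2 : z₂ * (y * (1 + y)) / (z₂ / B * v) = B * (y * (1 + y)) / v := by field_simp
    rw [e1, e2, mul_pow, mul_pow, mul_neg]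
    clear hl e1 e2
    generalize z₂ / B = l at hl0 ⊢
    field_simp
    ring
  have h2 := lkummer_symm (n + 1) m hz₂
  have hc : 0 < (m.factorial : ℝ) * (z₂ ^ (n + 1) / z₂ ^ m) := by positivity
  rw [← ENNReal.mul_right_inj (a := ENNReal.ofReal (m.factorial * (z₂ ^ (n + 1) / z₂ ^ m)))
    (ENNReal.ofReal_pos.2 hc).ne' ENNReal.ofReal_ne_top, mul_left_comm, ← h2, mul_left_comm, h1, ← mul_assoc,
    ← mul_assoc, ← ENNReal.ofReal_mul (by positivity), ← ENNReal.ofReal_mul (by positivity)]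
  congr 2
  rw [div_pow, div_pow]
  field_simp

lemma mem_interior_integrableExpSet_besselMeasure (n m : ℕ) {A B t : ℝ} (hA : 0 < A) (hB : 0 < B)
    (ht : 0 < t) :
    t ∈ interior (integrableExpSet (fun p => -p.1) (besselMeasure n m A B)) := by
  refine interior_maximal (t := Ioi 0) (fun t (ht : 0 < t) => ?_) isOpen_Ioi ht
  rw [integrableExpSet, mem_ofPred_eq, ← lintegral_ofReal_ne_top_iff_integrable (by fun_prop)
    (ae_of_all _ fun s => (exp_pos _).le), lintegral_besselMeasure _ _ _ _ (by fun_prop)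
      (fun _ _ _ _ => (exp_pos _).le)]
  -- decreasing `A` and `B` below `t / 2` reduces to a case where the integral is a finite product
  set z₁ := min A (t / 2) with h1
  set z₂ := min B (t / 2) with h2
  have hz₁ : 0 < z₁ := lt_min hA (by positivity)
  have hz₂ : 0 < z₂ := lt_min hB (by positivity)
  have h1A : z₁ ≤ A := min_le_left _ _
  have h2B : z₂ ≤ B := min_le_left _ _
  have hsum : z₁ + z₂ ≤ t := by linarith [min_le_right A (t / 2), min_le_right B (t / 2)]
  refine ne_top_of_le_ne_top (ENNReal.mul_lt_top (lkummer_lt_top (n + 1) (m + 1) hz₁)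
    (lkummer_lt_top m (n + 2) hz₂)).ne ?_
  rw [lkummer_mul_lkummer]
  refine setLIntegral_mono' measurableSet_Ioi fun y (hy : 0 < y) => ?_
  refine setLIntegral_mono' measurableSet_Ioi fun v (hv : 0 < v) => ENNReal.ofReal_le_ofReal ?_
  simp only [besselDensity]
  rw [mul_neg]
  gcongr

lemma mgf_mul_mgf_kummerMeasure (n m : ℕ) {z₁ z₂ A B : ℝ} (hz₁ : 0 < z₁) (hz₂ : 0 < z₂)
    (hA : 0 < A) (hB : 0 < B) (h : z₁ * z₂ = A * B) :
    mgf (fun s => -s) (kummerMeasure (n + 1) (m + 1)) z₁ *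
        mgf (fun s => -s) (kummerMeasure (n + 1) (m + 1)) z₂ =
      (n + 1).factorial / m.factorial * (B ^ m / B ^ (n + 1)) *
        mgf (fun p => -p.1) (besselMeasure n m A B) (z₁ + z₂) := by
  rw [mgf_kummerMeasure, mgf_kummerMeasure, ← ENNReal.toReal_mul,
    lkummer_mul_lkummer_eq n m hz₁ hz₂ hA hB h, ENNReal.toReal_mul,
    ENNReal.toReal_ofReal (by positivity), mgf,
    integral_eq_lintegral_of_nonneg_ae (ae_of_all _ fun s => (exp_pos _).le) (by fun_prop)]

/-- The identity `mgf_mul_mgf_kummerMeasure` extends to the right half plane, both sides being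
analytic there. -/
lemma complexMGF_mul_complexMGF_kummerMeasure (n m : ℕ) {z w : ℂ} {A B : ℝ} (hz : 0 < z.re)
    (hA : 0 < A) (hB : 0 < B) (h : z * w = A * B) :
    complexMGF (fun s => -s) (kummerMeasure (n + 1) (m + 1)) z *
        complexMGF (fun s => -s) (kummerMeasure (n + 1) (m + 1)) w =
      ((n + 1).factorial / m.factorial * (B ^ m / B ^ (n + 1)) : ℝ) *
        complexMGF (fun p => -p.1) (besselMeasure n m A B) (z + w) := by
  set U : Set ℂ := {z | 0 < z.re} with hU
  have hUo : IsOpen U := isOpen_lt continuous_const Complex.continuous_re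
  have hne : ∀ z ∈ U, z ≠ 0 := by
    rintro z hz rfl
    simp [hU] at hz
  have hinv : ∀ z ∈ U, 0 < ((A * B : ℝ) / z).re := by
    intro z hz
    have h0 := Complex.normSq_pos.2 (hne z hz)
    have : 0 < z.re := hz
    rw [div_eq_mul_inv, Complex.re_ofReal_mul, Complex.inv_re]
    positivity
  have hK : DifferentiableOn ℂ (complexMGF (fun s => -s) (kummerMeasure (n + 1) (m + 1))) U :=
    differentiableOn_complexMGF.mono fun z hz =>
      mem_interior_integrableExpSet_kummerMeasure _ _ hz
  have hB' : DifferentiableOn ℂ (complexMGF (fun p => -p.1) (besselMeasure n m A B)) U :=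
    differentiableOn_complexMGF.mono fun z hz =>
      mem_interior_integrableExpSet_besselMeasure _ _ hA hB hz
  have hd : DifferentiableOn ℂ (fun z : ℂ => (A * B : ℝ) / z) U :=
    (differentiableOn_const _).div differentiableOn_id hne
  have hL := (hK.mul (hK.comp hd hinv)).analyticOnNhd hUo
  have hR := ((hB'.comp (differentiableOn_id.add hd) (fun z (hz : 0 < z.re) => by
    have := hinv z hz
    simp only [hU, Pi.add_apply, id, mem_ofPred_eq, Complex.add_re]
    positivity)).const_mul
      (((n + 1).factorial / m.factorial * (B ^ m / B ^ (n + 1)) : ℝ) : ℂ)).analyticOnNhd hUo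
  have hconn : IsPreconnected U := (convex_halfSpace_re_gt 0).isPreconnected
  have h1U : (1 : ℂ) ∈ U := by simp [hU]
  have hreal : ∀ x : ℝ, 0 < x →
      complexMGF (fun s => -s) (kummerMeasure (n + 1) (m + 1)) x *
        complexMGF (fun s => -s) (kummerMeasure (n + 1) (m + 1)) ((A * B : ℝ) / x) =
      ((n + 1).factorial / m.factorial * (B ^ m / B ^ (n + 1)) : ℝ) *
        complexMGF (fun p => -p.1) (besselMeasure n m A B) (x + (A * B : ℝ) / x) := by
    intro x hx
    have := mgf_mul_mgf_kummerMeasure n m (z₁ := x) (z₂ := A * B / x) hx (by positivity) hA hB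
      (by field_simp)
    rw [← Complex.ofReal_div, ← Complex.ofReal_add, complexMGF_ofReal, complexMGF_ofReal,
      complexMGF_ofReal]
    exact_mod_cast this
  -- the positive reals accumulate at `1`
  have hfreq : ∃ᶠ x : ℂ in 𝓝[≠] 1,
      complexMGF (fun s => -s) (kummerMeasure (n + 1) (m + 1)) x *
        complexMGF (fun s => -s) (kummerMeasure (n + 1) (m + 1)) ((A * B : ℝ) / x) =
      ((n + 1).factorial / m.factorial * (B ^ m / B ^ (n + 1)) : ℝ) *
        complexMGF (fun p => -p.1) (besselMeasure n m A B) (x + (A * B : ℝ) / x) := by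
    have hev : ∀ᶠ x : ℝ in 𝓝[≠] 1, 0 < x :=
      nhdsWithin_le_nhds (Ioi_mem_nhds one_pos)
    have ht : Tendsto (fun x : ℝ => (x : ℂ)) (𝓝[≠] 1) (𝓝[≠] 1) := by
      refine tendsto_nhdsWithin_iff.2 ⟨?_, ?_⟩
      · exact_mod_cast (Complex.continuous_ofReal.tendsto 1).mono_left nhdsWithin_le_nhds
      · filter_upwards [self_mem_nhdsWithin] with x hx
        simpa using hx
    exact ht.frequently (hev.mono hreal).frequently
  have hw : w = (A * B : ℝ) / z := by
    rw [eq_div_iff (hne z hz), mul_comm, h, Complex.ofReal_mul]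
  rw [hw]
  exact hL.eqOn_of_preconnected_of_frequently_eq hR hconn h1U hfreq hz

/-! ### Whittaker functions and their derivatives -/

/-- The Laplace transform in the form of the integral in `whittakerW`. -/
lemma complexMGF_kummerMeasure (p q : ℕ) (z : ℂ) :
    complexMGF (fun s => -s) (kummerMeasure p q) z =
      ∫ s in Ioi (0 : ℝ), Complex.exp (-z * s) * (s : ℂ) ^ p / (1 + (s : ℂ)) ^ q := by
  rw [complexMGF, kummerMeasure, integral_withDensity_eq_integral_toReal_smul (by fun_prop)
    (ae_of_all _ fun s => ENNReal.ofReal_lt_top)]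
  refine setIntegral_congr_fun measurableSet_Ioi fun s (hs : 0 < s) => ?_
  rw [ENNReal.toReal_ofReal (by positivity), Complex.real_smul]
  push_cast
  rw [mul_neg, neg_mul]
  ring

lemma whittakerW_eq (n m : ℕ) (z : ℂ) :
    whittakerW (-((n : ℂ) + m + 2) / 2) (((n : ℂ) - m + 1) / 2) z =
      z ^ (((n : ℂ) - m + 2) / 2) * Complex.exp (-z / 2) / (n + 1).factorial *
        complexMGF (fun s => -s) (kummerMeasure (n + 1) (m + 1)) z := by
  have e1 : ((n : ℂ) - m + 1) / 2 + 1 / 2 = ((n : ℂ) - m + 2) / 2 := by ring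
  have e2 : ((n : ℂ) - m + 1) / 2 - -((n : ℂ) + m + 2) / 2 + 1 / 2 = ((n + 1 : ℕ) : ℂ) + 1 := by
    push_cast; ring
  have e3 : ((n : ℂ) - m + 1) / 2 - -((n : ℂ) + m + 2) / 2 - 1 / 2 = ((n + 1 : ℕ) : ℂ) := by
    push_cast; ring
  have e4 : ((n : ℂ) - m + 1) / 2 + -((n : ℂ) + m + 2) / 2 - 1 / 2 = -((m + 1 : ℕ) : ℂ) := by
    push_cast; ring
  rw [whittakerW, e1, e2, e3, e4, Complex.Gamma_nat_eq_factorial, complexMGF_kummerMeasure]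
  congr 1
  refine setIntegral_congr_fun measurableSet_Ioi fun s (hs : 0 < s) => ?_
  rw [Complex.cpow_natCast, Complex.cpow_neg, Complex.cpow_natCast, div_eq_mul_inv]

/-- Two complex numbers with positive sum and positive product have positive real parts: they are
either real or complex conjugates of each other. -/
lemma re_pos_of_add_mul_pos {z w : ℂ} {σ P : ℝ} (hσ : 0 < σ) (hP : 0 < P) (hs : z + w = σ)
    (hp : z * w = P) : 0 < z.re ∧ 0 < w.re := by
  have h1 := congrArg Complex.re hs
  have h2 := congrArg Complex.im hs
  have h3 := congrArg Complex.re hp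
  have h4 := congrArg Complex.im hp
  simp only [Complex.add_re, Complex.add_im, Complex.mul_re, Complex.mul_im, Complex.ofReal_re,
    Complex.ofReal_im] at h1 h2 h3 h4
  have hw : w.im = -z.im := by linarith
  rw [hw] at h3 h4
  have h5 : z.im * (w.re - z.re) = 0 := by linarith
  rcases mul_eq_zero.1 h5 with h | h
  · rw [h] at h3
    have h6 : 0 < z.re * w.re := by linarith
    rcases pos_and_pos_or_neg_and_neg_of_mul_pos h6 with h7 | h7
    · exact h7
    · linarith [h7.1, h7.2]
  · constructor <;> linarith

lemma mul_cpow_of_re_pos {z w : ℂ} (hz : 0 < z.re) (hw : 0 < w.re) (p : ℂ) :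
    (z * w) ^ p = z ^ p * w ^ p := by
  have hz0 : z ≠ 0 := by rintro rfl; simp at hz
  have hw0 : w ≠ 0 := by rintro rfl; simp at hw
  have h1 := abs_lt.1 (Complex.abs_arg_lt_pi_div_two_iff.2 (.inl hz))
  have h2 := abs_lt.1 (Complex.abs_arg_lt_pi_div_two_iff.2 (.inl hw))
  rw [Complex.cpow_def_of_ne_zero (mul_ne_zero hz0 hw0), Complex.cpow_def_of_ne_zero hz0,
    Complex.cpow_def_of_ne_zero hw0, Complex.log_mul hz0 hw0 ⟨by linarith, by linarith⟩, add_mul,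
    Complex.exp_add]

/-- The constant relating `whittakerProduct` to the Laplace transform of `besselMeasure`. -/
noncomputable def whittakerConst (n m : ℕ) (A B : ℝ) : ℝ :=
  (A * B) ^ (((n : ℝ) - m + 2) / 2) / ((n + 1).factorial * m.factorial) * (B ^ m / B ^ (n + 1))

/-- The arguments of the two Whittaker functions have sum `c * t / b₁` and product
`c ^ 2 / (b₁ * b₂ * β₁ * β₂)`, which is all that matters about the square root; the exponential
prefactor cancels the exponentials in the Whittaker functions. -/
lemma whittakerProduct_eq (n m : ℕ) {b₁ b₂ c β₁ β₂ t : ℝ} (hb₁ : 0 < b₁) (hb₂ : 0 < b₂) (hc : 0 < c)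
    (hβ₁ : 0 < β₁) (hβ₂ : 0 < β₂) (ht : 0 < t) :
    whittakerProduct n m b₁ b₂ c β₁ β₂ t =
      ((whittakerConst n m (1 / β₁) (c * (c / b₁) / (b₂ * β₂)) *
        mgf (fun p => -p.1) (besselMeasure n m (1 / β₁) (c * (c / b₁) / (b₂ * β₂)))
          (c / b₁ * t) : ℝ) : ℂ) := by
  have hroot : ((((t ^ 2 - 4 * b₁ / (b₂ * β₁ * β₂) : ℝ) : ℂ)) ^ (1 / 2 : ℂ)) ^ 2 =
      ((t ^ 2 - 4 * b₁ / (b₂ * β₁ * β₂) : ℝ) : ℂ) := by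
    rw [one_div]
    exact Complex.cpow_ofNat_inv_pow _ 2
  simp only [whittakerProduct]
  generalize (((t ^ 2 - 4 * b₁ / (b₂ * β₁ * β₂) : ℝ) : ℂ)) ^ (1 / 2 : ℂ) = root at hroot
  set A := 1 / β₁ with hA
  set B := c * (c / b₁) / (b₂ * β₂) with hB
  have hA0 : 0 < A := by positivity
  have hB0 : 0 < B := by positivity
  have hb₁' : (b₁ : ℂ) ≠ 0 := by exact_mod_cast hb₁.ne'
  have hb₂' : (b₂ : ℂ) ≠ 0 := by exact_mod_cast hb₂.ne'
  have hβ₁' : (β₁ : ℂ) ≠ 0 := by exact_mod_cast hβ₁.ne'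
  have hβ₂' : (β₂ : ℂ) ≠ 0 := by exact_mod_cast hβ₂.ne'
  set z : ℂ := c / (2 * b₁) * (t - root) with hz
  set w : ℂ := c / (2 * b₁) * (t + root) with hw
  have hsum : z + w = ((c / b₁ * t : ℝ) : ℂ) := by
    rw [hz, hw]; push_cast; field_simp; ring
  have hprod : z * w = ((A * B : ℝ) : ℂ) := by
    have : z * w = (c / (2 * b₁)) ^ 2 * (t ^ 2 - root ^ 2) := by rw [hz, hw]; ring
    rw [this, hroot, hA, hB]; push_cast; field_simp; ring
  obtain ⟨hz0, hw0⟩ := re_pos_of_add_mul_pos (by positivity) (by positivity) hsum hprod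
  have hkey := complexMGF_mul_complexMGF_kummerMeasure n m hz0 hA0 hB0
    (by rw [hprod]; push_cast; rfl)
  rw [hsum, complexMGF_ofReal] at hkey
  have hpow : z ^ (((n : ℂ) - m + 2) / 2) * w ^ (((n : ℂ) - m + 2) / 2) =
      (((A * B) ^ (((n : ℝ) - m + 2) / 2) : ℝ) : ℂ) := by
    rw [← mul_cpow_of_re_pos hz0 hw0, hprod, Complex.ofReal_cpow (by positivity)]
    push_cast
    rfl
  have hexp : Complex.exp (c * t / (2 * b₁)) * Complex.exp (-z / 2) * Complex.exp (-w / 2) = 1 := by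
    rw [← Complex.exp_add, ← Complex.exp_add, ← Complex.exp_zero]
    congr 1
    rw [hz, hw]; field_simp; ring
  have hfac : ((n + 1).factorial : ℂ) ≠ 0 := by exact_mod_cast (n + 1).factorial_ne_zero
  have hfac' : (m.factorial : ℂ) ≠ 0 := by exact_mod_cast m.factorial_ne_zero
  rw [whittakerW_eq, whittakerW_eq]
  calc _ = (Complex.exp (c * t / (2 * b₁)) * Complex.exp (-z / 2) * Complex.exp (-w / 2)) *
        (z ^ (((n : ℂ) - m + 2) / 2) * w ^ (((n : ℂ) - m + 2) / 2)) / (n + 1).factorial ^ 2 *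
        (complexMGF (fun s => -s) (kummerMeasure (n + 1) (m + 1)) z *
          complexMGF (fun s => -s) (kummerMeasure (n + 1) (m + 1)) w) := by ring
    _ = _ := by
      rw [hkey, hpow, hexp, whittakerConst]
      push_cast
      field_simp

lemma iteratedDeriv_whittakerProduct (n m j : ℕ) {b₁ b₂ c β₁ β₂ t : ℝ} (hb₁ : 0 < b₁) (hb₂ : 0 < b₂)
    (hc : 0 < c) (hβ₁ : 0 < β₁) (hβ₂ : 0 < β₂) (ht : 0 < t) :
    iteratedDeriv j (whittakerProduct n m b₁ b₂ c β₁ β₂) t =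
      ((whittakerConst n m (1 / β₁) (c * (c / b₁) / (b₂ * β₂)) * ((c / b₁) ^ j *
        ∫ p, (-p.1) ^ j * exp (c / b₁ * t * -p.1)
          ∂besselMeasure n m (1 / β₁) (c * (c / b₁) / (b₂ * β₂))) : ℝ) : ℂ) := by
  induction j generalizing t with
  | zero =>
    rw [iteratedDeriv_zero, whittakerProduct_eq n m hb₁ hb₂ hc hβ₁ hβ₂ ht]
    simp [mgf]
  | succ j ih =>
    have hev : iteratedDeriv j (whittakerProduct n m b₁ b₂ c β₁ β₂) =ᶠ[𝓝 t] fun t =>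
        ((whittakerConst n m (1 / β₁) (c * (c / b₁) / (b₂ * β₂)) * ((c / b₁) ^ j *
          ∫ p, (-p.1) ^ j * exp (c / b₁ * t * -p.1)
            ∂besselMeasure n m (1 / β₁) (c * (c / b₁) / (b₂ * β₂))) : ℝ) : ℂ) :=
      eventually_of_mem (Ioi_mem_nhds ht) fun s hs => ih hs
    rw [iteratedDeriv_succ, hev.deriv_eq]
    have h1 := hasDerivAt_integral_pow_mul_exp_real
      (mem_interior_integrableExpSet_besselMeasure n m (A := 1 / β₁)
        (B := c * (c / b₁) / (b₂ * β₂)) (t := c / b₁ * t) (by positivity) (by positivity)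
        (by positivity)) j
    have h2 := h1.comp t ((hasDerivAt_id t).const_mul (c / b₁))
    have h3 := ((h2.const_mul ((c / b₁) ^ j)).const_mul
      (whittakerConst n m (1 / β₁) (c * (c / b₁) / (b₂ * β₂)))).ofReal_comp
    refine h3.deriv.trans ?_
    congr 1
    ring

/-- Binomial theorem inside the derivatives of a Laplace transform. -/
lemma sum_choose_mul_integral {Ω : Type*} [MeasurableSpace Ω] {ν : Measure Ω} {Y : Ω → ℝ} {τ : ℝ}
    (hτ : τ ∈ interior (integrableExpSet (fun p => -Y p) ν)) {M R : ℕ} (hMR : M ≤ R) (a : ℝ) :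
    ∑ q ∈ Finset.range (M + 1), a ^ q / (-1) ^ (R - q) * (M.choose q : ℝ) *
        (a ^ (R - q) * ∫ p, (-Y p) ^ (R - q) * exp (τ * -Y p) ∂ν) =
      a ^ R * ∫ p, Y p ^ (R - M) * (1 + Y p) ^ M * exp (τ * -Y p) ∂ν := by
  have hint := fun j => integrable_pow_mul_exp_of_mem_interior_integrableExpSet hτ j
  have hpt : ∀ p, Y p ^ (R - M) * (1 + Y p) ^ M * exp (τ * -Y p) =
      ∑ q ∈ Finset.range (M + 1), (M.choose q : ℝ) * (-1) ^ (R - q) *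
        ((-Y p) ^ (R - q) * exp (τ * -Y p)) := by
    intro p
    rw [add_pow, Finset.mul_sum, Finset.sum_mul]
    refine Finset.sum_congr rfl fun q hq => ?_
    have hq' : q ≤ M := Nat.lt_succ_iff.1 (Finset.mem_range.1 hq)
    have h1 : (-Y p) ^ (R - q) = (-1) ^ (R - q) * (Y p ^ (R - M) * Y p ^ (M - q)) := by
      rw [neg_pow, ← pow_add, show R - M + (M - q) = R - q by omega]
    have h2 : ((-1 : ℝ) ^ (R - q)) * (-1) ^ (R - q) = 1 := by
      rw [← mul_pow]; simp
    rw [h1, one_pow]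
    linear_combination -(Y p ^ (R - M) * Y p ^ (M - q) * (M.choose q : ℝ) * exp (τ * -Y p)) * h2
  simp_rw [hpt]
  rw [integral_finsetSum _ fun q _ => (hint (R - q)).const_mul _, Finset.mul_sum]
  refine Finset.sum_congr rfl fun q hq => ?_
  have hq' : q ≤ R := (Nat.lt_succ_iff.1 (Finset.mem_range.1 hq)).trans hMR
  rw [integral_const_mul]
  have h2 : ((-1 : ℝ) ^ (R - q)) * (-1) ^ (R - q) = 1 := by
    rw [← mul_pow]; simp
  have h3 : a ^ R = a ^ q * a ^ (R - q) := by rw [← pow_add]; congr 1; omega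
  have h4 : ((-1 : ℝ) ^ (R - q)) ≠ 0 := left_ne_zero_of_mul_eq_one h2
  have h5 : a ^ q / (-1) ^ (R - q) = a ^ q * (-1) ^ (R - q) := by
    rw [div_eq_iff h4, mul_assoc, h2, mul_one]
  rw [h3, h5]
  generalize ∫ p, (-Y p) ^ (R - q) * exp (τ * -Y p) ∂ν = I
  ring

/-! ### The closed form as a sum of double integrals -/

/-- The integrand of the double integrals into which the mean of the gain ratio is expanded. -/
noncomputable def fadingIntegrand (n m r : ℕ) (A B σ : ℝ) (p : ℝ × ℝ) : ℝ :=
  p.1 ^ r * (1 + p.1) ^ m * (p.2 ^ n / p.2 ^ m) *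
    exp (-(σ * p.1) - A * p.2 - B * (p.1 * (1 + p.1)) / p.2)

lemma besselDensity_mul_eq_fadingIntegrand (n m i : ℕ) (A B σ : ℝ) {p : ℝ × ℝ} (h1 : 0 < p.1) :
    besselDensity n m A B p * (p.1 ^ i * (1 + p.1) ^ (n + m + 2) * exp (σ * -p.1)) =
      fadingIntegrand n m (i + m) A B σ p := by
  have he : exp (-(A * p.2) - B * (p.1 * (1 + p.1)) / p.2) * exp (σ * -p.1) =
      exp (-(σ * p.1) - A * p.2 - B * (p.1 * (1 + p.1)) / p.2) := by
    rw [← exp_add]; congr 1; ring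
  have h : (1 + p.1) ^ (n + m + 2) / (1 + p.1) ^ (n + 2) = (1 + p.1) ^ m := by
    rw [show n + m + 2 = m + (n + 2) by ring, pow_add]
    field_simp
  rw [fadingIntegrand, besselDensity, ← he, ← h, pow_add]
  ring

/-- The exponent of the first variable is taken to be at least `m`: for `n < m` the integral over
the second variable can grow near zero like a negative power of the first. -/
lemma integrable_fadingIntegrand (n m i : ℕ) {A B σ : ℝ} (hA : 0 < A) (hB : 0 < B) (hσ : 0 < σ) :
    Integrable (fadingIntegrand n m (i + m) A B σ)
      ((volume.restrict (Ioi 0)).prod (volume.restrict (Ioi 0))) := by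
  have hint := fun j => integrable_pow_mul_exp_of_mem_interior_integrableExpSet
    (mem_interior_integrableExpSet_besselMeasure n m hA hB hσ) j
  have h1 : Integrable (fun p : ℝ × ℝ => p.1 ^ i * (1 + p.1) ^ (n + m + 2) * exp (σ * -p.1))
      (besselMeasure n m A B) := by
    have : (fun p : ℝ × ℝ => p.1 ^ i * (1 + p.1) ^ (n + m + 2) * exp (σ * -p.1)) = fun p =>
        ∑ q ∈ Finset.range (n + m + 3), ((n + m + 2).choose q : ℝ) * (-1) ^ (q + i) *
          ((-p.1) ^ (q + i) * exp (σ * -p.1)) := by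
      funext p
      rw [add_comm 1 p.1, add_pow, Finset.mul_sum, Finset.sum_mul]
      refine Finset.sum_congr rfl fun q _ => ?_
      rw [show (-p.1) ^ (q + i) = (-1) ^ (q + i) * p.1 ^ (q + i) from neg_pow _ _, one_pow]
      have h2 : ((-1 : ℝ) ^ (q + i)) * (-1) ^ (q + i) = 1 := by
        rw [← mul_pow]; simp
      rw [pow_add p.1]
      linear_combination -(p.1 ^ q * p.1 ^ i * ((n + m + 2).choose q : ℝ) * exp (σ * -p.1)) * h2
    rw [this]
    exact integrable_finsetSum _ fun q _ => (hint (q + i)).const_mul _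
  have hm := measurable_besselDensity n m A B
  rw [besselMeasure, integrable_withDensity_iff_integrable_smul' (by fun_prop)
    (ae_of_all _ fun s => ENNReal.ofReal_lt_top)] at h1
  refine h1.congr ?_
  filter_upwards [ae_quadrant_pos] with p hp
  rw [ENNReal.toReal_ofReal (besselDensity_nonneg n m A B hp.1 hp.2), smul_eq_mul,
    besselDensity_mul_eq_fadingIntegrand n m i A B σ hp.1]

lemma integral_besselMeasure (n m i : ℕ) (A B σ : ℝ) :
    ∫ p, p.1 ^ i * (1 + p.1) ^ (n + m + 2) * exp (σ * -p.1) ∂besselMeasure n m A B =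
      ∫ p, fadingIntegrand n m (i + m) A B σ p
        ∂((volume.restrict (Ioi 0)).prod (volume.restrict (Ioi 0))) := by
  have hm := measurable_besselDensity n m A B
  rw [besselMeasure, integral_withDensity_eq_integral_toReal_smul (by fun_prop)
    (ae_of_all _ fun s => ENNReal.ofReal_lt_top)]
  refine integral_congr_ae ?_
  filter_upwards [ae_quadrant_pos] with p hp
  rw [ENNReal.toReal_ofReal (besselDensity_nonneg n m A B hp.1 hp.2), smul_eq_mul,
    besselDensity_mul_eq_fadingIntegrand n m i A B σ hp.1]

/-- The coefficients in the expansion of the mean of the gain ratio into integrals of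
`fadingIntegrand`. -/
noncomputable def fadingCoeff (α₁ n k m : ℕ) (β₁ β₂ b₁ b₂ c : ℝ) : ℝ :=
  c / (b₁ * b₂) / (β₁ ^ α₁ * β₂ ^ k * ((α₁ - 1).factorial * k.factorial)) *
    ((α₁ - 1).choose n * k.choose m) * ((c / b₁) ^ (α₁ - 1 - n + m) * (c / b₂) ^ k)

lemma rpow_half_sub_sq {x : ℝ} (hx : 0 < x) (n m : ℕ) :
    (x ^ (((n : ℝ) - m) / 2)) ^ 2 = x ^ n / x ^ m := by
  rw [← rpow_natCast (x ^ (((n : ℝ) - m) / 2)), ← rpow_mul hx.le, ← rpow_natCast x n,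
    ← rpow_natCast x m, ← rpow_sub hx]
  congr 1
  push_cast
  ring

/-- The half-integer powers in the closed form combine into integer powers. -/
lemma calJ_coeff_eq {α₁ n k m : ℕ} (hn : n < α₁) (hmk : m ≤ k) {β₁ β₂ b₁ b₂ c : ℝ}
    (hβ₁ : 0 < β₁) (hβ₂ : 0 < β₂) (hb₁ : 0 < b₁) (hb₂ : 0 < b₂) (hc : 0 < c) :
    ((n + 1 : ℝ) * β₁ ^ (((n : ℝ) - m + 2 - 2 * α₁) / 2) * β₂ ^ (((m : ℝ) - n - 2 * k) / 2)
        / ((k - m).factorial * (α₁ - n - 1).factorial)) *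
      ((b₁ / b₂) ^ (((n : ℝ) - m + 2 + 2 * k) / 2) / c) *
      whittakerConst n m (1 / β₁) (c * (c / b₁) / (b₂ * β₂)) * (c / b₁) ^ (α₁ + k + 1) =
    fadingCoeff α₁ n k m β₁ β₂ b₁ b₂ c := by
  obtain ⟨i, rfl⟩ : ∃ i, α₁ = n + i + 1 := ⟨α₁ - n - 1, by omega⟩
  obtain ⟨l, rfl⟩ : ∃ l, k = m + l := ⟨k - m, by omega⟩
  -- in terms of `a = c / b₁` and `e = b₁ / b₂` both sides are monomials
  obtain ⟨a, ha, rfl⟩ : ∃ a, 0 < a ∧ c = a * b₁ := ⟨c / b₁, by positivity, by field_simp⟩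
  obtain ⟨e, he, rfl⟩ : ∃ e, 0 < e ∧ b₁ = e * b₂ := ⟨b₁ / b₂, by positivity, by field_simp⟩
  have h1 : β₁ ^ (((n : ℝ) - m + 2 - 2 * (n + i + 1 : ℕ)) / 2) =
      β₁ ^ (((n : ℝ) - m) / 2) * β₁ / β₁ ^ (n + i + 1) := by
    rw [show ((n : ℝ) - m + 2 - 2 * (n + i + 1 : ℕ)) / 2 =
      ((n : ℝ) - m) / 2 + 1 - (n + i + 1 : ℕ) by push_cast; ring, rpow_sub hβ₁, rpow_add hβ₁,
      rpow_one, rpow_natCast]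
  have h2 : β₂ ^ (((m : ℝ) - n - 2 * (m + l : ℕ)) / 2) =
      (β₂ ^ (((n : ℝ) - m) / 2))⁻¹ / β₂ ^ (m + l) := by
    rw [show ((m : ℝ) - n - 2 * (m + l : ℕ)) / 2 =
      -(((n : ℝ) - m) / 2) - (m + l : ℕ) by push_cast; ring, rpow_sub hβ₂, rpow_neg hβ₂.le,
      rpow_natCast]
  have h3 : e ^ (((n : ℝ) - m + 2 + 2 * (m + l : ℕ)) / 2) =
      e ^ (((n : ℝ) - m) / 2) * e ^ (m + l + 1) := by
    rw [show ((n : ℝ) - m + 2 + 2 * (m + l : ℕ)) / 2 =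
      ((n : ℝ) - m) / 2 + (m + l + 1 : ℕ) by push_cast; ring, rpow_add he, rpow_natCast]
  have h4 : (1 / β₁ * (a ^ 2 * e / β₂)) ^ (((n : ℝ) - m + 2) / 2) =
      (a ^ n / a ^ m) * e ^ (((n : ℝ) - m) / 2) /
        (β₁ ^ (((n : ℝ) - m) / 2) * β₂ ^ (((n : ℝ) - m) / 2)) * (1 / β₁ * (a ^ 2 * e / β₂)) := by
    rw [show ((n : ℝ) - m + 2) / 2 = ((n : ℝ) - m) / 2 + 1 by ring, rpow_add (by positivity),
      rpow_one, ← rpow_half_sub_sq ha, show 1 / β₁ * (a ^ 2 * e / β₂) = a ^ 2 * e / (β₁ * β₂) by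
      field_simp, div_rpow (by positivity) (by positivity), mul_rpow (by positivity) he.le,
      mul_rpow hβ₁.le hβ₂.le, ← rpow_natCast a 2, ← rpow_natCast _ 2, ← rpow_mul ha.le,
      ← rpow_mul ha.le, mul_comm ((2 : ℕ) : ℝ)]
  have e1 : a * (e * b₂) * (a * (e * b₂) / (e * b₂)) / (b₂ * β₂) = a ^ 2 * e / β₂ := by
    field_simp
  have e2 : e * b₂ / b₂ = e := by field_simp
  have e3 : a * (e * b₂) / (e * b₂) = a := by field_simp
  have e4 : a * (e * b₂) / b₂ = a * e := by field_simp
  have e5 : a * (e * b₂) / (e * b₂ * b₂) = a / b₂ := by field_simp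
  rw [fadingCoeff, whittakerConst, e1, e2, e3, e4, e5, h1, h2, h3, h4]
  have s2 := rpow_half_sub_sq hβ₂ n m
  have s3 := rpow_half_sub_sq he n m
  have p1 : 0 < β₁ ^ (((n : ℝ) - m) / 2) := by positivity
  have p2 : 0 < β₂ ^ (((n : ℝ) - m) / 2) := by positivity
  have p3 : 0 < e ^ (((n : ℝ) - m) / 2) := by positivity
  generalize β₁ ^ (((n : ℝ) - m) / 2) = X at p1 ⊢
  generalize β₂ ^ (((n : ℝ) - m) / 2) = Y at s2 p2 ⊢
  generalize e ^ (((n : ℝ) - m) / 2) = Z at s3 p3 ⊢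
  have f1 : ((n + i).choose n : ℝ) * n.factorial * i.factorial = (n + i).factorial := by
    have := Nat.choose_mul_factorial_mul_factorial (Nat.le_add_right n i)
    rw [Nat.add_sub_cancel_left] at this
    exact_mod_cast this
  have f2 : ((m + l).choose m : ℝ) * m.factorial * l.factorial = (m + l).factorial := by
    have := Nat.choose_mul_factorial_mul_factorial (Nat.le_add_right m l)
    rw [Nat.add_sub_cancel_left] at this
    exact_mod_cast this
  have g1 : n + i + 1 - n - 1 = i := by omega
  have g2 : m + l - m = l := by omega
  have g3 : n + i + 1 - 1 = n + i := by omega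
  have g4 : n + i - n = i := by omega
  rw [g1, g2, g3, g4, ← f1, ← f2, Nat.factorial_succ]
  -- the powers `X` of `β₁` cancel, while those of `β₂` and `b₁ / b₂` occur squared
  have c1 : 0 < ((n + i).choose n : ℝ) := by exact_mod_cast Nat.choose_pos (by omega)
  have c2 : 0 < ((m + l).choose m : ℝ) := by exact_mod_cast Nat.choose_pos (by omega)
  generalize ((n + i).choose n : ℝ) = C1 at c1 ⊢
  generalize ((m + l).choose m : ℝ) = C2 at c2 ⊢
  have key : Z ^ 2 * (β₂ ^ n * e ^ m) = Y ^ 2 * (e ^ n * β₂ ^ m) := by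
    rw [s2, s3]; field_simp
  push_cast
  rw [div_pow, div_pow, mul_pow, mul_pow]
  field_simp
  linear_combination (e ^ (m + l + 1) * a ^ n * (a ^ 2) ^ m * β₂ * a ^ (n + i + 1 + (m + l) + 1)) *
    key

/-- The closed form as a linear combination of integrals over the positive quadrant. -/
lemma calJ_eq_sum_integral (α₁ α₂ : ℕ) {β₁ β₂ b₁ b₂ c : ℝ}
    (hβ₁ : 0 < β₁) (hβ₂ : 0 < β₂) (hb₁ : 0 < b₁) (hb₂ : 0 < b₂) (hc : 0 < c) :
    calJ α₁ α₂ β₁ β₂ b₁ b₂ c =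
      ((∑ n ∈ Finset.range α₁, ∑ k ∈ Finset.range α₂, ∑ m ∈ Finset.range (k + 1),
        fadingCoeff α₁ n k m β₁ β₂ b₁ b₂ c *
          ∫ p, fadingIntegrand n m (α₁ - 1 - n + k) (1 / β₁) (c * (c / b₁) / (b₂ * β₂))
            (c / b₁ * (1 / β₁ + b₁ / (b₂ * β₂))) p
            ∂((volume.restrict (Ioi 0)).prod (volume.restrict (Ioi 0))) : ℝ) : ℂ) := by
  rw [calJ]
  simp only [Complex.ofReal_sum]
  refine Finset.sum_congr rfl fun n hn => Finset.sum_congr rfl fun k _ =>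
    Finset.sum_congr rfl fun m hm => ?_
  have hn' : n < α₁ := Finset.mem_range.1 hn
  have hm' : m ≤ k := Nat.lt_succ_iff.1 (Finset.mem_range.1 hm)
  simp_rw [iteratedDeriv_whittakerProduct n m _ hb₁ hb₂ hc hβ₁ hβ₂
    (t := 1 / β₁ + b₁ / (b₂ * β₂)) (by positivity)]
  have hsum := sum_choose_mul_integral (Y := fun p : ℝ × ℝ => p.1)
    (mem_interior_integrableExpSet_besselMeasure n m (A := 1 / β₁)
      (B := c * (c / b₁) / (b₂ * β₂)) (t := c / b₁ * (1 / β₁ + b₁ / (b₂ * β₂))) (by positivity)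
      (by positivity) (by positivity)) (M := n + m + 2) (R := α₁ + k + 1) (by omega) (c / b₁)
  rw [integral_besselMeasure, show α₁ + k + 1 - (n + m + 2) + m = α₁ - 1 - n + k by omega] at hsum
  rw [← calJ_coeff_eq hn' hm' hβ₁ hβ₂ hb₁ hb₂ hc, mul_assoc _ ((c / b₁) ^ (α₁ + k + 1)),
    ← hsum, Finset.mul_sum, Complex.ofReal_sum]
  refine Finset.sum_congr rfl fun q _ => ?_
  rw [← Complex.ofReal_mul]
  congr 1
  generalize ∫ p : ℝ × ℝ, (-p.1) ^ (α₁ + k + 1 - q) *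
    exp (c / b₁ * (1 / β₁ + b₁ / (b₂ * β₂)) * -p.1)
      ∂besselMeasure n m (1 / β₁) (c * (c / b₁) / (b₂ * β₂)) = I
  have : ((-1 : ℝ) ^ (α₁ + k + 1 - q)) ≠ 0 := pow_ne_zero _ (by norm_num)
  field_simp

/-! ### The mean of the gain ratio for Erlang gains -/

lemma gammaPDF_natCast {α : ℕ} (hα : 1 ≤ α) {r x : ℝ} (hx : 0 < x) :
    gammaPDF α r x =
      ENNReal.ofReal (r ^ α / (α - 1).factorial * x ^ (α - 1) * exp (-(r * x))) := by
  have h1 : Gamma (α : ℝ) = (α - 1).factorial := by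
    rw [← Gamma_nat_eq_factorial, Nat.cast_sub hα]; simp
  have h2 : (α : ℝ) - 1 = ((α - 1 : ℕ) : ℝ) := by rw [Nat.cast_sub hα]; simp
  rw [gammaPDF_of_nonneg hx.le, h1, h2, rpow_natCast, rpow_natCast]

lemma ae_gammaMeasure_pos (a r : ℝ) : ∀ᵐ x ∂gammaMeasure a r, 0 < x := by
  have hm : Measurable (gammaPDF a r) := (measurable_gammaPDFReal a r).ennreal_ofReal
  rw [gammaMeasure, ae_withDensity_iff hm]
  filter_upwards [Measure.ae_ne volume (0 : ℝ)] with x hx hpdf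
  rcases lt_or_gt_of_ne hx with h | h
  · exact absurd (gammaPDF_of_neg h) hpdf
  · exact h

/-- The tail of the Erlang distribution, from the binomial expansion of the shifted density. -/
lemma gammaMeasure_Ioi {α : ℕ} (hα : 1 ≤ α) {r Y : ℝ} (hr : 0 < r) (hY : 0 ≤ Y) :
    gammaMeasure α r (Ioi Y) =
      ENNReal.ofReal (exp (-(r * Y)) * ∑ k ∈ Finset.range α, (r * Y) ^ k / k.factorial) := by
  rw [gammaMeasure, withDensity_apply _ measurableSet_Ioi, setLIntegral_Ioi_eq_comp_add]
  have h : ∀ u ∈ Ioi (0 : ℝ), gammaPDF α r (Y + u) = ∑ k ∈ Finset.range α,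
      ENNReal.ofReal (exp (-(r * Y)) * (r ^ α / (α - 1).factorial * (Y ^ k * (α - 1).choose k))) *
        ENNReal.ofReal (u ^ (α - 1 - k) * exp (-(r * u))) := by
    intro u (hu : 0 < u)
    rw [gammaPDF_natCast hα (by positivity), add_pow, Nat.sub_add_cancel hα]
    have : ∀ k ∈ Finset.range α, ENNReal.ofReal
        (exp (-(r * Y)) * (r ^ α / (α - 1).factorial * (Y ^ k * (α - 1).choose k))) *
          ENNReal.ofReal (u ^ (α - 1 - k) * exp (-(r * u))) = ENNReal.ofReal
        ((exp (-(r * Y)) * (r ^ α / (α - 1).factorial * (Y ^ k * (α - 1).choose k))) *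
          (u ^ (α - 1 - k) * exp (-(r * u)))) :=
      fun k _ => (ENNReal.ofReal_mul (by positivity)).symm
    rw [Finset.sum_congr rfl this, ← ENNReal.ofReal_sum_of_nonneg fun k _ => by positivity]
    congr 1
    rw [mul_add, neg_add, exp_add, Finset.mul_sum, Finset.sum_mul]
    exact Finset.sum_congr rfl fun k _ => by ring
  rw [setLIntegral_congr_fun measurableSet_Ioi h,
    lintegral_finsetSum _ fun k _ => by fun_prop]
  have h2 : ∀ k ∈ Finset.range α, ∫⁻ u in Ioi (0 : ℝ), ENNReal.ofReal
      (exp (-(r * Y)) * (r ^ α / (α - 1).factorial * (Y ^ k * (α - 1).choose k))) *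
        ENNReal.ofReal (u ^ (α - 1 - k) * exp (-(r * u))) =
      ENNReal.ofReal (exp (-(r * Y)) * ((r * Y) ^ k / k.factorial)) := by
    intro k hk
    rw [lintegral_const_mul' _ _ ENNReal.ofReal_ne_top, lintegral_pow_mul_exp_neg_mul _ hr,
      ← ENNReal.ofReal_mul (by positivity)]
    congr 1
    obtain ⟨j, rfl⟩ : ∃ j, α = k + j + 1 :=
      ⟨α - k - 1, by have := Finset.mem_range.1 hk; omega⟩
    have f := Nat.choose_mul_factorial_mul_factorial (Nat.le_add_right k j)
    rw [Nat.add_sub_cancel_left] at f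
    have f' : ((k + j).choose k : ℝ) * k.factorial * j.factorial = (k + j).factorial := by
      exact_mod_cast f
    rw [show k + j + 1 - 1 = k + j by omega, show k + j - k = j by omega, mul_pow, ← f']
    have c1 : 0 < ((k + j).choose k : ℝ) := by exact_mod_cast Nat.choose_pos (by omega)
    field_simp
    ring
  rw [Finset.sum_congr rfl h2, ← ENNReal.ofReal_sum_of_nonneg fun k _ => by positivity,
    Finset.mul_sum]

lemma measurable_gainRatio (b₁ b₂ c : ℝ) :
    Measurable fun p : ℝ × ℝ => gainRatio b₁ b₂ c p.1 p.2 := by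
  unfold gainRatio
  fun_prop

lemma gainRatio_nonneg {b₁ b₂ c x z : ℝ} (hb₁ : 0 ≤ b₁) (hb₂ : 0 ≤ b₂) (hc : 0 ≤ c) (hx : 0 ≤ x)
    (hz : 0 ≤ z) : 0 ≤ gainRatio b₁ b₂ c x z := by
  unfold gainRatio
  positivity

/-- The level above which the second gain has to lie for the gain ratio to exceed
`c / (b₁ * b₂) * p.1`, when the first gain is `c / b₁ * p.1 + p.2`. -/
noncomputable def gainThreshold (b₁ b₂ c : ℝ) (p : ℝ × ℝ) : ℝ :=
  c / b₂ * p.1 + c * (c / b₁) / b₂ * (p.1 * (1 + p.1)) / p.2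

lemma lt_gainRatio_iff {b₁ b₂ c y u z : ℝ} (hb₁ : 0 < b₁) (hb₂ : 0 < b₂) (hc : 0 < c) (hy : 0 < y)
    (hu : 0 < u) (hz : 0 < z) :
    c / (b₁ * b₂) * y < gainRatio b₁ b₂ c (c / b₁ * y + u) z ↔
      gainThreshold b₁ b₂ c (y, u) < z := by
  have h1 : 0 < (c / b₁ * y + u) * b₁ + z * b₂ + c := by positivity
  have h2 : gainThreshold b₁ b₂ c (y, u) * u =
      c / (b₁ * b₂) * y * ((c / b₁ * y + u) * b₁ + z * b₂ + c) - c / b₁ * y * z := by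
    rw [gainThreshold]; field_simp; ring
  have h3 : gainThreshold b₁ b₂ c (y, u) * u < z * u ↔ gainThreshold b₁ b₂ c (y, u) < z :=
    mul_lt_mul_iff_left₀ hu
  rw [gainRatio, lt_div_iff₀ h1, ← h3, h2]
  constructor <;> intro h <;> linarith

lemma gainRatio_le_of_le {b₁ b₂ c y x z : ℝ} (hb₁ : 0 < b₁) (hb₂ : 0 < b₂) (hc : 0 < c)
    (hy : 0 < y) (hx : 0 ≤ x) (hxy : x ≤ c / b₁ * y) (hz : 0 < z) :
    gainRatio b₁ b₂ c x z ≤ c / (b₁ * b₂) * y := by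
  have h1 : 0 < x * b₁ + z * b₂ + c := by positivity
  rw [gainRatio, div_le_iff₀ h1]
  have h2 : c / (b₁ * b₂) * y * (x * b₁ + z * b₂ + c) =
      c / (b₁ * b₂) * y * (x * b₁ + c) + c / b₁ * y * z := by
    field_simp
    ring
  have h3 : 0 ≤ c / (b₁ * b₂) * y * (x * b₁ + c) := by positivity
  rw [h2]
  nlinarith

/-- The density of the first gain times the tail probability of the second, at the points described
in `gainThreshold`. -/
noncomputable def erlangJoint (α₁ α₂ : ℕ) (β₁ β₂ b₁ b₂ c : ℝ) (p : ℝ × ℝ) : ℝ :=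
  (1 / β₁) ^ α₁ / (α₁ - 1).factorial * (c / b₁ * p.1 + p.2) ^ (α₁ - 1) *
      exp (-(1 / β₁ * (c / b₁ * p.1 + p.2))) *
    (exp (-(1 / β₂ * gainThreshold b₁ b₂ c p)) *
      ∑ k ∈ Finset.range α₂, (1 / β₂ * gainThreshold b₁ b₂ c p) ^ k / k.factorial)

/-- The tail probability of the gain ratio, with the first gain written as `c / b₁ * y + u`. -/
lemma measure_lt_gainRatio {α₁ α₂ : ℕ} (hα₁ : 1 ≤ α₁) (hα₂ : 1 ≤ α₂) {β₁ β₂ b₁ b₂ c y : ℝ}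
    (hβ₁ : 0 < β₁) (hβ₂ : 0 < β₂) (hb₁ : 0 < b₁) (hb₂ : 0 < b₂) (hc : 0 < c) (hy : 0 < y) :
    ((gammaMeasure α₁ (1 / β₁)).prod (gammaMeasure α₂ (1 / β₂)))
        {p | c / (b₁ * b₂) * y < gainRatio b₁ b₂ c p.1 p.2} =
      ∫⁻ u in Ioi (0 : ℝ), ENNReal.ofReal (erlangJoint α₁ α₂ β₁ β₂ b₁ b₂ c (y, u)) := by
  have : IsProbabilityMeasure (gammaMeasure α₂ (1 / β₂)) :=
    isProbabilityMeasure_gammaMeasure (by positivity) (by positivity)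
  have hS : MeasurableSet {p : ℝ × ℝ | c / (b₁ * b₂) * y < gainRatio b₁ b₂ c p.1 p.2} :=
    measurableSet_lt measurable_const (measurable_gainRatio b₁ b₂ c)
  have hm : Measurable (gammaPDF (α₁ : ℝ) (1 / β₁)) :=
    (measurable_gammaPDFReal _ _).ennreal_ofReal
  rw [Measure.prod_apply hS, gammaMeasure, lintegral_withDensity_eq_lintegral_mul _ hm
    (measurable_measure_prodMk_left hS)]
  have hzero : ∀ x, x ∉ Ioi (c / b₁ * y) →
      (gammaPDF (α₁ : ℝ) (1 / β₁) * fun x => gammaMeasure (α₂ : ℝ) (1 / β₂)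
        (Prod.mk x ⁻¹' {p | c / (b₁ * b₂) * y < gainRatio b₁ b₂ c p.1 p.2})) x = 0 := by
    intro x hx
    rw [mem_Ioi, not_lt] at hx
    rw [Pi.mul_apply]
    rcases lt_or_ge x 0 with h | h
    · rw [gammaPDF_of_neg h, zero_mul]
    · have : gammaMeasure (α₂ : ℝ) (1 / β₂)
          (Prod.mk x ⁻¹' {p | c / (b₁ * b₂) * y < gainRatio b₁ b₂ c p.1 p.2}) = 0 := by
        rw [measure_eq_zero_iff_ae_notMem]
        filter_upwards [ae_gammaMeasure_pos α₂ (1 / β₂)] with z hz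
        exact not_lt.2 (gainRatio_le_of_le hb₁ hb₂ hc hy h hx hz)
      rw [this, mul_zero]
  rw [← indicator_eq_self.2 (Function.support_subset_iff'.2 hzero),
    lintegral_indicator measurableSet_Ioi, setLIntegral_Ioi_eq_comp_add]
  refine setLIntegral_congr_fun measurableSet_Ioi fun u (hu : 0 < u) => ?_
  have hY : 0 ≤ gainThreshold b₁ b₂ c (y, u) := by unfold gainThreshold; positivity
  have htail : gammaMeasure (α₂ : ℝ) (1 / β₂)
      (Prod.mk (c / b₁ * y + u) ⁻¹' {p | c / (b₁ * b₂) * y < gainRatio b₁ b₂ c p.1 p.2}) =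
      gammaMeasure (α₂ : ℝ) (1 / β₂) (Ioi (gainThreshold b₁ b₂ c (y, u))) := by
    refine measure_congr ?_
    filter_upwards [ae_gammaMeasure_pos α₂ (1 / β₂)] with z hz
    exact propext (lt_gainRatio_iff hb₁ hb₂ hc hy hu hz)
  rw [Pi.mul_apply, htail, gammaMeasure_Ioi hα₂ (by positivity) hY,
    gammaPDF_natCast hα₁ (by positivity), ← ENNReal.ofReal_mul (by positivity), erlangJoint]

/-- Binomial expansion of `(c / b₁ * y + u) ^ (α₁ - 1)`, indexed by `n`, and of the powers of the
threshold in the tail of the second gain, indexed by `m`. -/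
lemma mul_erlangJoint_eq_sum (α₁ α₂ : ℕ) (hα₁ : 1 ≤ α₁) {β₁ β₂ b₁ b₂ c : ℝ}
    (hβ₁ : 0 < β₁) (hβ₂ : 0 < β₂) (hb₁ : 0 < b₁) (hb₂ : 0 < b₂) {p : ℝ × ℝ} (hp : 0 < p.2) :
    c / (b₁ * b₂) * erlangJoint α₁ α₂ β₁ β₂ b₁ b₂ c p =
      ∑ n ∈ Finset.range α₁, ∑ k ∈ Finset.range α₂, ∑ m ∈ Finset.range (k + 1),
        fadingCoeff α₁ n k m β₁ β₂ b₁ b₂ c *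
          fadingIntegrand n m (α₁ - 1 - n + k) (1 / β₁) (c * (c / b₁) / (b₂ * β₂))
            (c / b₁ * (1 / β₁ + b₁ / (b₂ * β₂))) p := by
  obtain ⟨y, u⟩ := p
  replace hp : 0 < u := hp
  have hthr : ∀ k : ℕ, gainThreshold b₁ b₂ c (y, u) ^ k = (c / b₂ * y) ^ k *
      ∑ m ∈ Finset.range (k + 1), (c / b₁ * (1 + y) / u) ^ m * (k.choose m : ℝ) := by
    intro k
    have : gainThreshold b₁ b₂ c (y, u) = c / b₂ * y * (c / b₁ * (1 + y) / u + 1) := by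
      rw [gainThreshold]; ring
    rw [this, mul_pow, add_pow]
    simp
  have hexp : exp (-(1 / β₁ * (c / b₁ * y + u))) *
      exp (-(1 / β₂ * gainThreshold b₁ b₂ c (y, u))) =
      exp (-(c / b₁ * (1 / β₁ + b₁ / (b₂ * β₂)) * y) - 1 / β₁ * u -
        c * (c / b₁) / (b₂ * β₂) * (y * (1 + y)) / u) := by
    rw [← exp_add, gainThreshold]
    congr 1
    field_simp
    ring
  have hbin : (c / b₁ * y + u) ^ (α₁ - 1) = ∑ n ∈ Finset.range α₁,
      u ^ n * (c / b₁ * y) ^ (α₁ - 1 - n) * ((α₁ - 1).choose n : ℝ) := by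
    rw [add_comm, add_pow, Nat.sub_add_cancel hα₁]
  calc c / (b₁ * b₂) * erlangJoint α₁ α₂ β₁ β₂ b₁ b₂ c (y, u)
      = c / (b₁ * b₂) * ((1 / β₁) ^ α₁ / (α₁ - 1).factorial) *
        (exp (-(1 / β₁ * (c / b₁ * y + u))) *
          exp (-(1 / β₂ * gainThreshold b₁ b₂ c (y, u)))) *
        ((c / b₁ * y + u) ^ (α₁ - 1) *
          ∑ k ∈ Finset.range α₂, (1 / β₂ * gainThreshold b₁ b₂ c (y, u)) ^ k / k.factorial) := by
        rw [erlangJoint]; ring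
    _ = _ := by
      rw [hexp, hbin, Finset.sum_mul, Finset.mul_sum]
      refine Finset.sum_congr rfl fun n _ => ?_
      rw [Finset.mul_sum, Finset.mul_sum]
      refine Finset.sum_congr rfl fun k _ => ?_
      rw [mul_pow (1 / β₂), hthr, Finset.mul_sum, Finset.mul_sum, Finset.sum_div, Finset.mul_sum,
        Finset.mul_sum]
      refine Finset.sum_congr rfl fun m _ => ?_
      rw [fadingIntegrand, fadingCoeff, div_pow (c / b₁ * (1 + y)) u, mul_pow (c / b₁) (1 + y)]
      simp only
      generalize exp (-(c / b₁ * (1 / β₁ + b₁ / (b₂ * β₂)) * y) - 1 / β₁ * u -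
        c * (c / b₁) / (b₂ * β₂) * (y * (1 + y)) / u) = E
      ring

/-- The closed form is the mean of the gain ratio under independent Erlang gains, by the layer cake
formula at the levels `c / (b₁ * b₂) * y`. -/
lemma calJ_eq_integral_gainRatio {α₁ α₂ : ℕ} (hα₁ : 1 ≤ α₁) (hα₂ : 1 ≤ α₂) {β₁ β₂ b₁ b₂ c : ℝ}
    (hβ₁ : 0 < β₁) (hβ₂ : 0 < β₂) (hb₁ : 0 < b₁) (hb₂ : 0 < b₂) (hc : 0 < c) :
    calJ α₁ α₂ β₁ β₂ b₁ b₂ c = ((∫ p, gainRatio b₁ b₂ c p.1 p.2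
      ∂((gammaMeasure α₁ (1 / β₁)).prod (gammaMeasure α₂ (1 / β₂))) : ℝ) : ℂ) := by
  have : IsProbabilityMeasure (gammaMeasure α₁ (1 / β₁)) :=
    isProbabilityMeasure_gammaMeasure (by positivity) (by positivity)
  have : IsProbabilityMeasure (gammaMeasure α₂ (1 / β₂)) :=
    isProbabilityMeasure_gammaMeasure (by positivity) (by positivity)
  have hs : 0 < c / (b₁ * b₂) := by positivity
  have hnn : 0 ≤ᵐ[(gammaMeasure α₁ (1 / β₁)).prod (gammaMeasure α₂ (1 / β₂))]
      fun p => gainRatio b₁ b₂ c p.1 p.2 := by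
    filter_upwards [Measure.quasiMeasurePreserving_fst.ae (ae_gammaMeasure_pos α₁ (1 / β₁)),
      Measure.quasiMeasurePreserving_snd.ae (ae_gammaMeasure_pos α₂ (1 / β₂))] with p h1 h2
    exact gainRatio_nonneg hb₁.le hb₂.le hc.le h1.le h2.le
  have hterm : ∀ n k m, n ∈ Finset.range α₁ → m ∈ Finset.range (k + 1) →
      Integrable (fun p => fadingCoeff α₁ n k m β₁ β₂ b₁ b₂ c *
          fadingIntegrand n m (α₁ - 1 - n + k) (1 / β₁) (c * (c / b₁) / (b₂ * β₂))
            (c / b₁ * (1 / β₁ + b₁ / (b₂ * β₂))) p)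
        ((volume.restrict (Ioi 0)).prod (volume.restrict (Ioi 0))) := by
    intro n k m hn hm
    obtain ⟨i, hi⟩ : ∃ i, α₁ - 1 - n + k = i + m :=
      ⟨α₁ - 1 - n + k - m, by have := Finset.mem_range.1 hm; omega⟩
    rw [hi]
    exact (integrable_fadingIntegrand n m i (by positivity) (by positivity)
      (by positivity)).const_mul _
  have hmeas : Measurable (erlangJoint α₁ α₂ β₁ β₂ b₁ b₂ c) := by
    unfold erlangJoint gainThreshold
    fun_prop
  have hlint : ∫⁻ p, ENNReal.ofReal (gainRatio b₁ b₂ c p.1 p.2)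
        ∂((gammaMeasure α₁ (1 / β₁)).prod (gammaMeasure α₂ (1 / β₂))) =
      ∫⁻ p, ENNReal.ofReal (c / (b₁ * b₂) * erlangJoint α₁ α₂ β₁ β₂ b₁ b₂ c p)
        ∂((volume.restrict (Ioi 0)).prod (volume.restrict (Ioi 0))) := by
    rw [lintegral_eq_lintegral_meas_lt _ hnn (measurable_gainRatio b₁ b₂ c).aemeasurable,
      setLIntegral_Ioi_zero_comp_mul hs]
    simp_rw [ENNReal.ofReal_mul hs.le]
    rw [lintegral_const_mul' _ _ ENNReal.ofReal_ne_top,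
      lintegral_prod _ hmeas.ennreal_ofReal.aemeasurable]
    congr 1
    exact setLIntegral_congr_fun measurableSet_Ioi fun y hy =>
      measure_lt_gainRatio hα₁ hα₂ hβ₁ hβ₂ hb₁ hb₂ hc hy
  rw [calJ_eq_sum_integral α₁ α₂ hβ₁ hβ₂ hb₁ hb₂ hc]
  congr 1
  rw [integral_eq_lintegral_of_nonneg_ae hnn (measurable_gainRatio b₁ b₂ c).aestronglyMeasurable,
    hlint, ← integral_eq_lintegral_of_nonneg_ae _ (by fun_prop)]
  · rw [integral_congr_ae (ae_quadrant_pos.mono fun p hp =>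
      mul_erlangJoint_eq_sum α₁ α₂ hα₁ hβ₁ hβ₂ hb₁ hb₂ hp.2),
      integral_finsetSum _ fun n hn => integrable_finsetSum _ fun k _ =>
        integrable_finsetSum _ fun m hm => hterm n k m hn hm]
    refine Finset.sum_congr rfl fun n hn => ?_
    rw [integral_finsetSum _ fun k _ => integrable_finsetSum _ fun m hm => hterm n k m hn hm]
    refine Finset.sum_congr rfl fun k _ => ?_
    rw [integral_finsetSum _ fun m hm => hterm n k m hn hm]
    simp_rw [integral_const_mul]
  · filter_upwards [ae_quadrant_pos] with p hp
    have := hp.1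
    have := hp.2
    unfold erlangJoint gainThreshold
    simp only [Pi.zero_apply]
    positivity

/-! ### Capacity bound -/

lemma integrable_id_gammaMeasure {α : ℕ} (hα : 1 ≤ α) {r : ℝ} (hr : 0 < r) :
    Integrable (fun x => x) (gammaMeasure α r) := by
  have hm : Measurable (gammaPDF (α : ℝ) r) := (measurable_gammaPDFReal _ _).ennreal_ofReal
  rw [← lintegral_ofReal_ne_top_iff_integrable (by fun_prop)
    ((ae_gammaMeasure_pos α r).mono fun x hx => hx.le), gammaMeasure,
    lintegral_withDensity_eq_lintegral_mul _ hm (by fun_prop)]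
  have hzero : ∀ x, x ∉ Ioi (0 : ℝ) →
      (gammaPDF (α : ℝ) r * fun x => ENNReal.ofReal x) x = 0 := by
    intro x hx
    rw [mem_Ioi, not_lt] at hx
    simp [ENNReal.ofReal_of_nonpos hx]
  rw [← indicator_eq_self.2 (Function.support_subset_iff'.2 hzero),
    lintegral_indicator measurableSet_Ioi]
  have h : ∀ x ∈ Ioi (0 : ℝ), (gammaPDF (α : ℝ) r * fun x => ENNReal.ofReal x) x =
      ENNReal.ofReal (r ^ α / (α - 1).factorial) *
        ENNReal.ofReal (x ^ α * exp (-(r * x))) := by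
    intro x (hx : 0 < x)
    rw [Pi.mul_apply, gammaPDF_natCast hα hx, ← ENNReal.ofReal_mul (by positivity),
      ← ENNReal.ofReal_mul (by positivity)]
    congr 1
    rw [← Nat.sub_add_cancel hα, Nat.add_sub_cancel, pow_succ x]
    ring
  rw [setLIntegral_congr_fun measurableSet_Ioi h, lintegral_const_mul' _ _ ENNReal.ofReal_ne_top,
    lintegral_pow_mul_exp_neg_mul _ hr]
  exact ENNReal.mul_ne_top ENNReal.ofReal_ne_top ENNReal.ofReal_ne_top

lemma gainRatio_le_div {b₁ b₂ c x z : ℝ} (hb₁ : 0 ≤ b₁) (hb₂ : 0 < b₂) (hc : 0 < c) (hx : 0 ≤ x)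
    (hz : 0 ≤ z) : gainRatio b₁ b₂ c x z ≤ x / b₂ := by
  rw [gainRatio, div_le_div_iff₀ (by positivity) hb₂]
  have h1 : 0 ≤ x * (x * b₁ + c) := by positivity
  linarith

/-- The tangent line at `J` of the concave function `x ↦ log (1 + x / (x * d + 1))` lies above the
function. -/
lemma log_one_add_div_le {d x J : ℝ} (hd : 0 ≤ d) (hx : 0 ≤ x) (hJ : 0 ≤ J) :
    log (1 + x / (x * d + 1)) ≤
      log (1 + J / (J * d + 1)) + (x - J) * ((J * d + 1) ^ 2 * (1 + J / (J * d + 1)))⁻¹ := by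
  have h1 : 0 < x * d + 1 := by positivity
  have h2 : 0 < J * d + 1 := by positivity
  have h3 : 0 < 1 + x / (x * d + 1) := by positivity
  have h4 : 0 < 1 + J / (J * d + 1) := by positivity
  have h5 : log (1 + x / (x * d + 1)) - log (1 + J / (J * d + 1)) ≤
      (1 + x / (x * d + 1)) / (1 + J / (J * d + 1)) - 1 := by
    rw [← log_div h3.ne' h4.ne']
    exact log_le_sub_one_of_pos (by positivity)
  have h6 : x / (x * d + 1) - J / (J * d + 1) ≤ (x - J) / (J * d + 1) ^ 2 := by
    have : (x - J) / (J * d + 1) ^ 2 - (x / (x * d + 1) - J / (J * d + 1)) =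
        d * (x - J) ^ 2 / ((J * d + 1) ^ 2 * (x * d + 1)) := by
      field_simp
      ring
    have h7 : 0 ≤ d * (x - J) ^ 2 / ((J * d + 1) ^ 2 * (x * d + 1)) := by positivity
    linarith
  have h8 : (1 + x / (x * d + 1)) / (1 + J / (J * d + 1)) - 1 =
      (x / (x * d + 1) - J / (J * d + 1)) / (1 + J / (J * d + 1)) := by
    rw [div_sub_one h4.ne']
    congr 1
    ring
  have h9 : (x - J) * ((J * d + 1) ^ 2 * (1 + J / (J * d + 1)))⁻¹ =
      (x - J) / (J * d + 1) ^ 2 / (1 + J / (J * d + 1)) := by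
    rw [mul_inv, ← mul_assoc, ← div_eq_mul_inv, ← div_eq_mul_inv]
  have h10 := div_le_div_of_nonneg_right h6 h4.le
  rw [h9]
  linarith

/-- Jensen's inequality for the ergodic capacity. -/
lemma ergodicCapacity_le {Ω : Type*} [MeasurableSpace Ω] {μ : Measure Ω} [IsProbabilityMeasure μ]
    {g γ : Ω → ℝ} {d : ℝ} (hd : 0 ≤ d) (hg : Integrable g μ) (hg0 : ∀ ω, 0 ≤ g ω)
    (hγ : ∀ ω, γ ω = g ω / (g ω * d + 1)) :
    Integrable (fun ω => logb 2 (1 + γ ω)) μ ∧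
      ergodicCapacity μ γ ≤ 1 / 2 * logb 2 (1 + (∫ ω, g ω ∂μ) / ((∫ ω, g ω ∂μ) * d + 1)) := by
  obtain rfl : γ = fun ω => g ω / (g ω * d + 1) := funext hγ
  set J := ∫ ω, g ω ∂μ with hJ
  have hJ0 : 0 ≤ J := integral_nonneg hg0
  have hgm : AEMeasurable g μ := hg.aemeasurable
  have hlog : Integrable (fun ω => log (1 + g ω / (g ω * d + 1))) μ := by
    have hm : AEMeasurable (fun ω => log (1 + g ω / (g ω * d + 1))) μ := by fun_prop
    refine hg.mono' hm.aestronglyMeasurable (ae_of_all _ fun ω => ?_)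
    have h0 := hg0 ω
    have h1 : 0 ≤ g ω / (g ω * d + 1) := by positivity
    rw [norm_eq_abs, abs_of_nonneg (log_nonneg (by linarith))]
    have h2 := log_le_sub_one_of_pos (x := 1 + g ω / (g ω * d + 1)) (by linarith)
    have h3 : g ω / (g ω * d + 1) ≤ g ω :=
      div_le_self h0 (by nlinarith [mul_nonneg h0 hd])
    linarith
  have hsub : Integrable (fun ω => (g ω - J) * ((J * d + 1) ^ 2 * (1 + J / (J * d + 1)))⁻¹) μ :=
    (hg.sub (integrable_const _)).mul_const _
  have hlin : Integrable (fun ω => log (1 + J / (J * d + 1)) +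
      (g ω - J) * ((J * d + 1) ^ 2 * (1 + J / (J * d + 1)))⁻¹) μ :=
    (integrable_const _).add hsub
  have hle : ∫ ω, log (1 + g ω / (g ω * d + 1)) ∂μ ≤ log (1 + J / (J * d + 1)) := by
    refine (integral_mono hlog hlin fun ω => log_one_add_div_le hd (hg0 ω) hJ0).trans (le_of_eq ?_)
    rw [integral_add (integrable_const _) hsub, integral_mul_const, integral_sub hg (integrable_const _)]
    simp [← hJ]
  refine ⟨hlog.div_const _, ?_⟩
  rw [ergodicCapacity]
  simp only [logb]
  rw [integral_div]
  have : 0 < log 2 := log_pos (by norm_num)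
  gcongr

lemma distortion_nonneg (κ₁ κ₂ : ℝ) : 0 ≤ distortion κ₁ κ₂ := by
  unfold distortion
  positivity

/-- The signal-to-noise-and-distortion ratio as a function of the gain ratio. -/
lemma div_eq_gainRatio_div {b₁ b₂ c d x z : ℝ} (hb₁ : 0 ≤ b₁) (hb₂ : 0 < b₂) (hc : 0 < c)
    (hx : 0 ≤ x) (hz : 0 ≤ z) :
    x * z / (x * z * d + (x * b₁ + z * b₂ + c)) =
      gainRatio b₁ b₂ c x z / (gainRatio b₁ b₂ c x z * d + 1) := by
  have h : 0 < x * b₁ + z * b₂ + c := by positivity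
  have h1 : gainRatio b₁ b₂ c x z * d + 1 =
      (x * z * d + (x * b₁ + z * b₂ + c)) / (x * b₁ + z * b₂ + c) := by
    rw [gainRatio]
    field_simp
  rw [h1, gainRatio, div_div_div_cancel_right₀ h.ne']

end AFRelay

theorem theorem3 {Ω : Type*} [MeasurableSpace Ω] (μ : Measure Ω) [IsProbabilityMeasure μ]
    (h₁ h₂ : Ω → ℂ) (α₁ α₂ : ℕ) (hα₁ : 1 ≤ α₁) (hα₂ : 1 ≤ α₂)
    (β₁ β₂ : ℝ) (hβ₁ : 0 < β₁) (hβ₂ : 0 < β₂)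
    (hh₁ : AFRelay.IsNakagami μ h₁ α₁ β₁) (hh₂ : AFRelay.IsNakagami μ h₂ α₂ β₂)
    (hindep : IndepFun (fun ω => ‖h₁ ω‖) (fun ω => ‖h₂ ω‖) μ)
    (P₁ P₂ N₁ N₂ : ℝ) (hP₁ : 0 < P₁) (hP₂ : 0 < P₂) (hN₁ : 0 < N₁) (hN₂ : 0 < N₂)
    (κ₁ κ₂ : ℝ) (hκ₁ : 0 ≤ κ₁) (hκ₂ : 0 ≤ κ₂) (ρ₁ ρ₂ : Ω → ℝ)
    (hρ₁ : ρ₁ = fun ω => ‖h₁ ω‖ ^ 2) (hρ₂ : ρ₂ = fun ω => ‖h₂ ω‖ ^ 2) :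
    -- variable gain relaying
    (∀ (b₁ b₂ c d : ℝ) (γ : Ω → ℝ) (J : ℂ),
      b₁ = N₂ * (1 + κ₁ ^ 2) / P₂ → b₂ = N₁ * (1 + κ₂ ^ 2) / P₁ → c = N₁ * N₂ / (P₁ * P₂) →
      d = AFRelay.distortion κ₁ κ₂ →
      (γ = fun ω => AFRelay.sndrVariable P₁ P₂ N₁ N₂ κ₁ κ₂ (ρ₁ ω) (ρ₂ ω)) →
      J = AFRelay.calJ α₁ α₂ β₁ β₂ b₁ b₂ c →
        Integrable (fun ω => AFRelay.gainRatio b₁ b₂ c (ρ₁ ω) (ρ₂ ω)) μ ∧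
        J = ((∫ ω, AFRelay.gainRatio b₁ b₂ c (ρ₁ ω) (ρ₂ ω) ∂μ : ℝ) : ℂ) ∧
        Integrable (fun ω => Real.logb 2 (1 + γ ω)) μ ∧
        AFRelay.ergodicCapacity μ γ ≤ 1 / 2 * Real.logb 2 (1 + J.re / (J.re * d + 1))) ∧
    -- fixed gain relaying: `b₁ = 0`, where the closed form is read as its limit as `b₁ → 0+`
    (∀ (G b₂ c d : ℝ) (γ : Ω → ℝ),
      G = AFRelay.fixedGain P₁ P₂ N₁ κ₁ (∫ ω, ρ₁ ω ∂μ) →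
      b₂ = N₁ * (1 + κ₂ ^ 2) / P₁ → c = N₂ / (P₁ * G ^ 2) →
      d = AFRelay.distortion κ₁ κ₂ →
      (γ = fun ω => AFRelay.sndrFixed P₁ N₁ N₂ κ₁ κ₂ G (ρ₁ ω) (ρ₂ ω)) →
        ∃ J : ℂ,
          Tendsto (fun b₁ : ℝ => AFRelay.calJ α₁ α₂ β₁ β₂ b₁ b₂ c) (𝓝[>] 0) (𝓝 J) ∧
          Integrable (fun ω => AFRelay.gainRatio 0 b₂ c (ρ₁ ω) (ρ₂ ω)) μ ∧
          J = ((∫ ω, AFRelay.gainRatio 0 b₂ c (ρ₁ ω) (ρ₂ ω) ∂μ : ℝ) : ℂ) ∧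
          Integrable (fun ω => Real.logb 2 (1 + γ ω)) μ ∧
          AFRelay.ergodicCapacity μ γ ≤ 1 / 2 * Real.logb 2 (1 + J.re / (J.re * d + 1))) := by

  have hm₁ : HasLaw ρ₁ (gammaMeasure (α₁ : ℝ) (1 / β₁)) μ := hρ₁ ▸ hh₁
  have hm₂ : HasLaw ρ₂ (gammaMeasure (α₂ : ℝ) (1 / β₂)) μ := hρ₂ ▸ hh₂
  have hρ₁0 : ∀ ω, 0 ≤ ρ₁ ω := fun ω => by rw [hρ₁]; positivity
  have hρ₂0 : ∀ ω, 0 ≤ ρ₂ ω := fun ω => by rw [hρ₂]; positivity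
  have hind : IndepFun ρ₁ ρ₂ μ := by
    rw [hρ₁, hρ₂]
    exact hindep.comp (φ := fun x : ℝ => x ^ 2) (ψ := fun x : ℝ => x ^ 2) (by fun_prop)
      (by fun_prop)
  have hmap : μ.map (fun ω => (ρ₁ ω, ρ₂ ω)) =
      (gammaMeasure (α₁ : ℝ) (1 / β₁)).prod (gammaMeasure (α₂ : ℝ) (1 / β₂)) := by
    rw [(indepFun_iff_map_prod_eq_prod_map_map hm₁.aemeasurable hm₂.aemeasurable).1 hind,
      hm₁.map_eq, hm₂.map_eq]
  have hρm : AEMeasurable (fun ω => (ρ₁ ω, ρ₂ ω)) μ :=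
    hm₁.aemeasurable.prodMk hm₂.aemeasurable
  have hint : Integrable ρ₁ μ := by
    have h := AFRelay.integrable_id_gammaMeasure hα₁ (one_div_pos.2 hβ₁)
    rw [← hm₁.map_eq] at h
    exact h.comp_aemeasurable hm₁.aemeasurable
  have hgm : ∀ b₁ b₂ c : ℝ, AEStronglyMeasurable
      (fun ω => AFRelay.gainRatio b₁ b₂ c (ρ₁ ω) (ρ₂ ω)) μ := fun b₁ b₂ c =>
    ((AFRelay.measurable_gainRatio b₁ b₂ c).comp_aemeasurable hρm).aestronglyMeasurable
  have hg0 : ∀ {b₁ b₂ c : ℝ}, 0 ≤ b₁ → 0 < b₂ → 0 < c → ∀ ω,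
      0 ≤ AFRelay.gainRatio b₁ b₂ c (ρ₁ ω) (ρ₂ ω) := fun hb₁ hb₂ hc ω =>
    AFRelay.gainRatio_nonneg hb₁ hb₂.le hc.le (hρ₁0 ω) (hρ₂0 ω)
  have hgle : ∀ {b₁ b₂ c : ℝ}, 0 ≤ b₁ → 0 < b₂ → 0 < c → ∀ ω,
      ‖AFRelay.gainRatio b₁ b₂ c (ρ₁ ω) (ρ₂ ω)‖ ≤ ρ₁ ω / b₂ := fun hb₁ hb₂ hc ω => by
    rw [Real.norm_eq_abs, abs_of_nonneg (hg0 hb₁ hb₂ hc ω)]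
    exact AFRelay.gainRatio_le_div hb₁ hb₂ hc (hρ₁0 ω) (hρ₂0 ω)
  have hgint : ∀ {b₁ b₂ c : ℝ}, 0 ≤ b₁ → 0 < b₂ → 0 < c →
      Integrable (fun ω => AFRelay.gainRatio b₁ b₂ c (ρ₁ ω) (ρ₂ ω)) μ := fun hb₁ hb₂ hc =>
    (hint.div_const _).mono' (hgm _ _ _) (ae_of_all _ (hgle hb₁ hb₂ hc))
  have hcalJ : ∀ {b₁ b₂ c : ℝ}, 0 < b₁ → 0 < b₂ → 0 < c →
      AFRelay.calJ α₁ α₂ β₁ β₂ b₁ b₂ c =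
        ((∫ ω, AFRelay.gainRatio b₁ b₂ c (ρ₁ ω) (ρ₂ ω) ∂μ : ℝ) : ℂ) := fun hb₁ hb₂ hc => by
    rw [AFRelay.calJ_eq_integral_gainRatio hα₁ hα₂ hβ₁ hβ₂ hb₁ hb₂ hc, ← hmap,
      integral_map hρm (AFRelay.measurable_gainRatio _ _ _).aestronglyMeasurable]
  constructor
  · intro b₁ b₂ c d γ J hb₁ hb₂ hc hd hγ hJ
    have hb₁0 : 0 < b₁ := by rw [hb₁]; positivity
    have hb₂0 : 0 < b₂ := by rw [hb₂]; positivity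
    have hc0 : 0 < c := by rw [hc]; positivity
    have hJ' := hJ.trans (hcalJ hb₁0 hb₂0 hc0)
    have hcap := AFRelay.ergodicCapacity_le (γ := γ) (d := d)
      (hd ▸ AFRelay.distortion_nonneg κ₁ κ₂) (hgint hb₁0.le hb₂0 hc0) (hg0 hb₁0.le hb₂0 hc0)
      fun ω => by
        rw [← AFRelay.div_eq_gainRatio_div hb₁0.le hb₂0 hc0 (hρ₁0 ω) (hρ₂0 ω), hγ, hb₁, hb₂, hc, hd]
        simp only [AFRelay.sndrVariable]
        congr 1
        ring
    refine ⟨hgint hb₁0.le hb₂0 hc0, hJ', hcap.1, ?_⟩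
    rw [hJ', Complex.ofReal_re]
    exact hcap.2
  · intro G b₂ c d γ hG hb₂ hc hd hγ
    have hmean : 0 ≤ ∫ ω, ρ₁ ω ∂μ := integral_nonneg hρ₁0
    have hG0 : 0 < G := by
      rw [hG, AFRelay.fixedGain]
      exact Real.sqrt_pos.2 (by positivity)
    have hb₂0 : 0 < b₂ := by rw [hb₂]; positivity
    have hc0 : 0 < c := by rw [hc]; positivity
    have hcap := AFRelay.ergodicCapacity_le (γ := γ) (d := d)
      (hd ▸ AFRelay.distortion_nonneg κ₁ κ₂) (hgint le_rfl hb₂0 hc0) (hg0 le_rfl hb₂0 hc0)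
      fun ω => by
        rw [← AFRelay.div_eq_gainRatio_div le_rfl hb₂0 hc0 (hρ₁0 ω) (hρ₂0 ω), hγ, hb₂, hc, hd]
        simp only [AFRelay.sndrFixed]
        congr 1
        ring
    -- `ρ₁ / b₂` dominates the gain ratio uniformly in `b₁ ≥ 0`
    refine ⟨_, ?_, hgint le_rfl hb₂0 hc0, rfl, hcap.1, ?_⟩
    · have hlim : Tendsto
          (fun b₁ : ℝ => ∫ ω, AFRelay.gainRatio b₁ b₂ c (ρ₁ ω) (ρ₂ ω) ∂μ) (𝓝[>] 0)
          (𝓝 (∫ ω, AFRelay.gainRatio 0 b₂ c (ρ₁ ω) (ρ₂ ω) ∂μ)) := by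
        refine tendsto_integral_filter_of_dominated_convergence (fun ω => ρ₁ ω / b₂)
          (.of_forall fun b₁ => hgm b₁ b₂ c) ?_ (hint.div_const _) (ae_of_all _ fun ω => ?_)
        · filter_upwards [self_mem_nhdsWithin] with b₁ hb₁
          exact ae_of_all _ (hgle (le_of_lt hb₁) hb₂0 hc0)
        · have h0 : ρ₁ ω * 0 + ρ₂ ω * b₂ + c ≠ 0 := by
            have := hρ₂0 ω
            rw [mul_zero, zero_add]
            positivity
          have hcont : ContinuousAt
              (fun b₁ : ℝ => AFRelay.gainRatio b₁ b₂ c (ρ₁ ω) (ρ₂ ω)) 0 := by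
            unfold AFRelay.gainRatio
            exact ContinuousAt.div (by fun_prop) (by fun_prop) h0
          exact hcont.tendsto.mono_left nhdsWithin_le_nhds
      refine ((Complex.continuous_ofReal.tendsto _).comp hlim).congr' ?_
      filter_upwards [self_mem_nhdsWithin] with b₁ hb₁
      exact (hcalJ hb₁ hb₂0 hc0).symm
    · rw [Complex.ofReal_re]
      exact hcap.2
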